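/- Let $W\ge 0$ and $J>0$ be constants independent of $n$ (thermal noise power and mean scene power). For a pattern $a=(a_0,\dots,a_{n-1})\in\mathbb{R}^n$ let $A=A(a)$ be the $n\times n$ circulant matrix $A_{ji}=a_{(i-j)\bmod n}$, and for a transmissivity $\rho\in(0,1]$ define the normalized mutual information of the mask $a$ in the IID scene model (scene covariance $I$) by $$\overline{\mathcal I}(a;\rho)=\frac1n\log\det\Big(\frac{1}{W+\rho J}\cdot\frac1n\,AA^T+I\Big).$$ Let $X$ be a random variable with density $f_X(x)=|x|e^{-x^2}$ on $\mathbb{R}$. For each $n$, let $a^{(n)}$ be a random pattern of length $n$ with i.i.d. $\mathrm{Uniform}[0,1]$ entries, and put $\overline{\mathcal I}_{\mathrm{uniform}}=\overline{\mathcal I}(a^{(n)};\tfrac12)$. Then, as $n\to\infty$, $\overline{\mathcal I}_{\mathrm{uniform}}$ converges in probability to the finite constant $$\widetilde{\mathcal I}_{\mathrm{uniform}}=\mathbb E_X\Big[\log\Big(\frac{1/12}{W+J/2}X^2+1\Big)\Big].$$ Moreover, for $p\in[\tfrac12-\tfrac1{\sqrt6},\tfrac12]$ put $\widetilde{\mathcal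 I}_p=\mathbb E_X\big[\log\big(\frac{p(1-p)}{W+pJ}X^2+1\big)\big]$, which is finite. Then $\widetilde{\mathcal I}_{\mathrm{uniform}}<\widetilde{\mathcal I}_p$ for every such $p$. Hence random on-off masks with such $p$ outperform random uniform masks: if for each $n$ the pattern $b^{(n)}$ has i.i.d. $\mathrm{Bernoulli}(p)$ entries and is defined on the same probability space as $a^{(n)}$ (with any joint law), then $\overline{\mathcal I}_p=\overline{\mathcal I}(b^{(n)};p)$ converges in probability to $\widetilde{\mathcal I}_p$, and $\mathbb P(\overline{\mathcal I}_{\mathrm{uniform}}<\overline{\mathcal I}_p)\to1$ as $n\to\infty$. -/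

import Mathlib

open MeasureTheory ProbabilityTheory Filter Topology

noncomputable section

/-- The circulant transfer matrix of a mask pattern `a = (a₀, …, aₙ₋₁)`: the entry in row `j` and
column `i` is `a_{(i - j) mod n}` (subtraction in `Fin n` is modulo `n`), so `a` is the first row. -/
def transferMatrix {n : ℕ} (a : Fin n → ℝ) : Matrix (Fin n) (Fin n) ℝ :=
  Matrix.of fun j i => a (i - j)

/-- The mutual information between scene and measurements, for scene covariance `Q`, transfer
matrix `A`, thermal noise power `W`, scene power `J` and transmissivity `ρ` (with `n` pixels and
`n` scene bins): `log det ((1 / (W + ρ J)) (1 / n) A Q Aᵀ + I)`. -/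
def mutualInfo {n : ℕ} (W J ρ : ℝ) (Q A : Matrix (Fin n) (Fin n) ℝ) : ℝ :=
  Real.log ((1 / (W + ρ * J)) • (1 / (n : ℝ)) • (A * Q * A.transpose) + 1).det

/-- Normalized mutual information per pixel of the circulant mask with pattern `a`, for the IID
scene, i.e. for the scene covariance `Q = I`. -/
def normalizedMI {n : ℕ} (W J ρ : ℝ) (a : Fin n → ℝ) : ℝ :=
  mutualInfo W J ρ 1 (transferMatrix a) / n

/-- The law on `ℝ` with density `|x| exp (-x²)`. -/
def symmRayleigh : Measure ℝ :=
  volume.withDensity fun x => ENNReal.ofReal (|x| * Real.exp (-x ^ 2))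

/-- `E_X[log (c X² + 1)]` for `X` with density `|x| exp (-x²)`. -/
def limitMI (c : ℝ) : ℝ :=
  ∫ x, Real.log (c * x ^ 2 + 1) ∂symmRayleigh

/-- Random uniform pattern of length `n`: i.i.d. entries, uniform on `[0, 1]`. -/
def IsRandomUniform {Ω : Type*} [MeasurableSpace Ω] (P : Measure Ω) {n : ℕ}
    (a : Fin n → Ω → ℝ) : Prop :=
  iIndepFun a P ∧ ∀ i, HasLaw (a i) (volume.restrict (Set.Icc (0 : ℝ) 1)) P

/-- Random on-off pattern of length `n`: i.i.d. entries, equal to `1` with probability `p` and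
to `0` with probability `1 - p`. -/
def IsRandomOnOff {Ω : Type*} [MeasurableSpace Ω] (P : Measure Ω) (p : unitInterval) {n : ℕ}
    (b : Fin n → Ω → ℝ) : Prop :=
  iIndepFun b P ∧ ∀ i, HasLaw (b i) (bernoulliMeasure (1 : ℝ) 0 p) P

end

/-!
A circulant matrix is diagonalized by the characters of `ZMod n`, so the normalized mutual
information is the average over the frequencies `k` of `log (c ‖â k‖² / n + 1)`, where `â` is the
discrete Fourier transform of the pattern and `c = 1 / (W + ρ J)` (`normalizedMI_eq_sum`). The mean
`m` of the entries is visible only at the frequency zero, a single term of size `O(log n)`, so the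
pattern may be centered (`abs_normalizedMI_sub_powerMean_le`). What has to be shown is that, for
independent entries with values in `[0, 1]`, mean `m` and variance `v`, the empirical law of the
normalized centered coefficients `z k = (a - m)^ k / √n` tends to the complex Gaussian law of
variance `v`, tested against `z ↦ log (c ‖z‖² + 1)`; then `‖z‖²` is distributed as `v X²`.

For the test functions `z ↦ exp (i ⟪τ, z⟫)` this is a second moment computation. Each `⟪τ, z k⟫`
is a linear form in the independent entries with coefficients of order `1 / √n`, and outside `O(n)`
exceptional pairs of frequencies these forms are orthogonal; a product expansion of the
characteristic function therefore gives asymptotic normality of single forms and asymptotic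
independence of pairs
(`IsUnitLaw.norm_charFun_linear_sub_gaussian_le`, `IsUnitLaw.norm_integral_cross_le`,
`IsUnitLaw.integral_norm_empiricalCharFun_sub_sq_le`).

The passage from characters to the logarithm uses no tightness or truncation argument: `L¹`
convergence is stable under dominated superpositions of test functions
(`tendsto_integral_abs_integral`, `IsUnitLaw.powerMeanTendsto_integral`), and the logarithm is an
iterated superposition of cosines,

* `exp (-s ‖z‖²) = ∫ π⁻¹ exp (-‖w‖²) cos ⟪2 √s w, z⟫ dw`,
* `1 / (1 + θ y) = ∫ exp (-s) exp (-s θ y) ds` over `s > 0`,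
* `log (c y + 1) = ∫ y / (1 + θ y) dθ` over `0 < θ ≤ c`.

The domination in the last step is uniform in `n` since Parseval's identity bounds the average of
`‖z k‖²` by one. Convergence in `L¹` under the product law of the entries gives convergence in
probability by Markov's inequality.

The comparison of the two limits is the strict monotonicity of `limitMI`: for `p` in the given range
`p (1 - p) ≥ 1 / 12` and `W + p J ≤ W + J / 2`, and the two inequalities are never both equalities.
-/

noncomputable section

/-! ### Circulant matrices and the discrete Fourier transform -/

/-- The discrete Fourier transform `k ↦ ∑ j, ψ (j k) a j` of a pattern, for the standard character
`ψ x = exp (2 π i x / n)`, without normalization. The sign of the exponent is opposite to that of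
`ZMod.dft`, which exchanges the frequencies `k` and `-k`. -/
def maskDFT {n : ℕ} [NeZero n] (a : ZMod n → ℝ) (k : ZMod n) : ℂ :=
  ∑ j, ZMod.stdAddChar (j * k) * (a j : ℂ)

lemma sum_stdAddChar_mul {n : ℕ} [NeZero n] (k : ZMod n) :
    ∑ j : ZMod n, ZMod.stdAddChar (j * k) = if k = 0 then (n : ℂ) else 0 := by
  have h := AddChar.sum_mulShift k (ZMod.isPrimitive_stdAddChar n)
  rw [h]; split_ifs <;> simp [ZMod.card]

lemma conj_stdAddChar {n : ℕ} [NeZero n] (j : ZMod n) :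
    (starRingEnd ℂ) (ZMod.stdAddChar j) = ZMod.stdAddChar (-j) :=
  (AddChar.map_neg_eq_conj _ _).symm

lemma norm_stdAddChar {n : ℕ} [NeZero n] (j : ZMod n) :
    ‖(ZMod.stdAddChar j : ℂ)‖ = 1 := AddChar.norm_apply _ _

lemma conj_maskDFT {n : ℕ} [NeZero n] (a : ZMod n → ℝ) (k : ZMod n) :
    (starRingEnd ℂ) (maskDFT a k) = ∑ j, ZMod.stdAddChar (-(j * k)) * (a j : ℂ) := by
  simp [maskDFT, map_sum, conj_stdAddChar]

/-- The discrete Fourier matrix, whose columns are the characters of `ZMod n`. -/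
def fourierMatrix (n : ℕ) [NeZero n] : Matrix (ZMod n) (ZMod n) ℂ :=
  Matrix.of fun j k => ZMod.stdAddChar (j * k)

lemma det_fourierMatrix_ne_zero (n : ℕ) [NeZero n] : (fourierMatrix n).det ≠ 0 := by
  have h : (fourierMatrix n).conjTranspose * fourierMatrix n = (n : ℂ) • 1 := by
    ext k l
    simp only [Matrix.mul_apply, Matrix.conjTranspose_apply, fourierMatrix, Matrix.of_apply,
      Matrix.smul_apply, Matrix.one_apply, RCLike.star_def, conj_stdAddChar,
      ← AddChar.map_add_eq_mul]
    rw [Finset.sum_congr rfl (g := fun j => ZMod.stdAddChar (j * (l - k)))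
      (fun j _ => by congr 1; ring), sum_stdAddChar_mul]
    simp [sub_eq_zero, eq_comm]
  intro h0
  have := congrArg Matrix.det h
  rw [Matrix.det_mul, h0, mul_zero, Matrix.det_smul, Matrix.det_one, mul_one] at this
  exact pow_ne_zero _ (Nat.cast_ne_zero.2 (NeZero.ne n)) this.symm

/-- The characters diagonalize a circulant matrix and its transpose simultaneously. -/
lemma det_circulant_gram {n : ℕ} [NeZero n] (a : ZMod n → ℝ) (c : ℝ)
    (A : Matrix (ZMod n) (ZMod n) ℝ) (hA : ∀ j i, A j i = a (i - j)) :
    (c • (A * A.transpose) + 1).det = ∏ k, (c * ‖maskDFT a k‖ ^ 2 + 1) := by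
  set B := A.map (algebraMap ℝ ℂ)
  have h1 : B * fourierMatrix n = fourierMatrix n * Matrix.diagonal (maskDFT a) := by
    ext j k
    rw [Matrix.mul_diagonal, Matrix.mul_apply]
    simp only [B, Matrix.map_apply, hA, fourierMatrix, Matrix.of_apply, maskDFT, Finset.mul_sum]
    rw [← Equiv.sum_comp (Equiv.addRight j)]
    refine Finset.sum_congr rfl fun x _ => ?_
    simp only [Equiv.coe_addRight, add_sub_cancel_right, add_mul, AddChar.map_add_eq_mul,
      Complex.coe_algebraMap]
    ring
  have h2 : B.transpose * fourierMatrix n =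
      fourierMatrix n * Matrix.diagonal (fun k => (starRingEnd ℂ) (maskDFT a k)) := by
    ext j k
    rw [Matrix.mul_diagonal, Matrix.mul_apply]
    simp only [conj_maskDFT]
    simp only [B, Matrix.map_apply, Matrix.transpose_apply, hA, fourierMatrix, Matrix.of_apply,
      Finset.mul_sum]
    rw [← Equiv.sum_comp (Equiv.subLeft j)]
    refine Finset.sum_congr rfl fun x _ => ?_
    simp only [Equiv.subLeft_apply, sub_sub_cancel, Complex.coe_algebraMap]
    rw [show (j - x) * k = j * k + -(x * k) by ring, AddChar.map_add_eq_mul]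
    ring
  have h3 : ((c : ℂ) • (B * B.transpose) + 1) * fourierMatrix n =
      fourierMatrix n * Matrix.diagonal (fun k => ((c * ‖maskDFT a k‖ ^ 2 + 1 : ℝ) : ℂ)) := by
    rw [add_mul, one_mul, Matrix.smul_mul, Matrix.mul_assoc, h2, ← Matrix.mul_assoc, h1,
      Matrix.mul_assoc, Matrix.diagonal_mul_diagonal]
    ext j k
    simp only [Matrix.add_apply, Matrix.smul_apply, Matrix.mul_diagonal, Complex.mul_conj,
      Complex.normSq_eq_norm_sq, smul_eq_mul]
    push_cast
    ring
  have h4 := congrArg Matrix.det h3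
  rw [Matrix.det_mul, Matrix.det_mul, mul_comm, Matrix.det_diagonal] at h4
  have h5 := mul_left_cancel₀ (det_fourierMatrix_ne_zero n) h4
  have h6 : (c : ℂ) • (B * B.transpose) + 1 =
      (algebraMap ℝ ℂ).mapMatrix (c • (A * A.transpose) + 1) := by
    rw [map_add, map_one]
    congr 1
    ext i j
    simp [B, Matrix.mul_apply]
  rw [h6, ← RingHom.map_det, ← Complex.ofReal_prod] at h5
  exact Complex.ofReal_injective h5

/-- Parseval's identity. -/
lemma sum_norm_maskDFT_sq {n : ℕ} [NeZero n] (a : ZMod n → ℝ) :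
    ∑ k, ‖maskDFT a k‖ ^ 2 = n * ∑ j, a j ^ 2 := by
  have h : ∑ k, maskDFT a k * (starRingEnd ℂ) (maskDFT a k) = (n : ℂ) * ∑ j, (a j : ℂ) ^ 2 := by
    simp only [conj_maskDFT]
    simp only [maskDFT, Finset.sum_mul_sum]
    rw [Finset.sum_comm, Finset.mul_sum]
    refine Finset.sum_congr rfl fun j _ => ?_
    rw [Finset.sum_comm]
    have : ∀ l : ZMod n, ∑ k : ZMod n, (ZMod.stdAddChar (j * k) * (a j : ℂ)) *
        (ZMod.stdAddChar (-(l * k)) * (a l : ℂ)) =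
          if j = l then (n : ℂ) * (a j : ℂ) ^ 2 else 0 := by
      intro l
      have h1 : ∀ k : ZMod n, (ZMod.stdAddChar (j * k) * (a j : ℂ)) *
        (ZMod.stdAddChar (-(l * k)) * (a l : ℂ)) =
          ((a j : ℂ) * a l) * ZMod.stdAddChar (k * (j - l)) := by
        intro k
        rw [show k * (j - l) = j * k + -(l * k) by ring, AddChar.map_add_eq_mul]; ring
      simp only [h1, ← Finset.mul_sum, sum_stdAddChar_mul, sub_eq_zero]
      split_ifs with h
      · subst h; ring
      · simp
    simp [this]
  simp only [Complex.mul_conj, Complex.normSq_eq_norm_sq] at h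
  exact_mod_cast h

/-- Subtracting a constant from the pattern only affects the zero frequency. -/
lemma maskDFT_sub_const {n : ℕ} [NeZero n] (a : ZMod n → ℝ) (m : ℝ) {k : ZMod n} (hk : k ≠ 0) :
    maskDFT (fun j => a j - m) k = maskDFT a k := by
  simp only [maskDFT, Complex.ofReal_sub, mul_sub, Finset.sum_sub_distrib, ← Finset.sum_mul,
    sum_stdAddChar_mul, if_neg hk, zero_mul, sub_zero]

lemma card_two_mul_eq_zero_le (n : ℕ) [NeZero n] :
    (Finset.univ.filter fun k : ZMod n => 2 * k = 0).card ≤ 2 := by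
  refine (Finset.card_le_card (t := {0, ((n / 2 : ℕ) : ZMod n)}) ?_).trans Finset.card_le_two
  intro k hk
  simp only [Finset.mem_filter, Finset.mem_univ, true_and] at hk
  have h1 : ((2 * k.val : ℕ) : ZMod n) = 0 := by push_cast; rw [ZMod.natCast_zmod_val, hk]
  obtain ⟨c, hc⟩ := (ZMod.natCast_eq_zero_iff _ _).1 h1
  have h2 := ZMod.val_lt k
  have hc2 : c < 2 := by
    by_contra hcc
    have : n * 2 ≤ n * c := Nat.mul_le_mul_left _ (by omega)
    omega
  simp only [Finset.mem_insert, Finset.mem_singleton]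
  interval_cases c
  · left; exact (ZMod.val_eq_zero k).1 (by omega)
  · right; rw [← ZMod.natCast_zmod_val k]; congr 1; omega

/-- For an IID scene the normalized mutual information is an average over frequencies. -/
lemma normalizedMI_eq_sum (W J ρ : ℝ) (hρ : 0 < W + ρ * J) (n : ℕ)
    (a : ZMod (n + 1) → ℝ) :
    normalizedMI (n := n + 1) W J ρ a = (∑ k : ZMod (n + 1),
      Real.log (1 / (W + ρ * J) * (‖maskDFT a k‖ ^ 2 / ((n + 1 : ℕ) : ℝ)) + 1)) /
        ((n + 1 : ℕ) : ℝ) := by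
  have h := det_circulant_gram (n := n + 1) a (1 / (W + ρ * J) * (1 / ((n + 1 : ℕ) : ℝ)))
    (transferMatrix a) (fun j i => rfl)
  -- `ZMod (n + 1)` and `Fin (n + 1)` agree definitionally, including the cyclic subtraction
  have h' : ((1 / (W + ρ * J) * (1 / ((n + 1 : ℕ) : ℝ))) •
      (transferMatrix a * (transferMatrix a).transpose) + 1).det =
      ∏ k : ZMod (n + 1),
        (1 / (W + ρ * J) * (1 / ((n + 1 : ℕ) : ℝ)) * ‖maskDFT a k‖ ^ 2 + 1) := h
  have h'' : normalizedMI (n := n + 1) W J ρ a = Real.log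
      ((1 / (W + ρ * J)) • (1 / ((n + 1 : ℕ) : ℝ)) •
        (transferMatrix (n := n + 1) a * 1 * (transferMatrix (n := n + 1) a).transpose) + 1).det /
          ((n + 1 : ℕ) : ℝ) := rfl
  rw [h'', Matrix.mul_one, smul_smul, h', Real.log_prod]
  · congr 1
    refine Finset.sum_congr rfl fun k _ => ?_
    congr 2
    ring
  · intro k _
    positivity

/-! ### Characteristic functions of linear forms in independent variables -/

lemma norm_cexp_sub_quadratic_le (y : ℝ) :
    ‖Complex.exp (y * Complex.I) - (1 + y * Complex.I - (y : ℂ) ^ 2 / 2)‖ ≤ 4 * |y| ^ 3 := by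
  have hn : ‖(y * Complex.I : ℂ)‖ = |y| := by simp
  rcases le_total |y| 1 with h | h
  · have := Complex.exp_bound (x := y * Complex.I) (by rw [hn]; exact h) (n := 3) (by norm_num)
    rw [hn] at this
    have he : ∑ m ∈ Finset.range 3, (y * Complex.I : ℂ) ^ m / (m.factorial : ℂ) =
        1 + y * Complex.I - (y : ℂ) ^ 2 / 2 := by
      simp [Finset.sum_range_succ, mul_pow]; ring
    rw [he] at this
    refine this.trans ?_
    norm_num [Nat.factorial]
    nlinarith [pow_nonneg (abs_nonneg y) 3]
  · have h1 : ‖Complex.exp (y * Complex.I)‖ = 1 := Complex.norm_exp_ofReal_mul_I y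
    have h2 : ‖(1 + y * Complex.I - (y : ℂ) ^ 2 / 2)‖ ≤ 1 + |y| + |y| ^ 2 / 2 := by
      refine (norm_sub_le _ _).trans (add_le_add ((norm_add_le _ _).trans ?_) ?_)
      · simp
      · simp
    refine (norm_sub_le _ _).trans ?_
    rw [h1]
    nlinarith [mul_nonneg (sub_nonneg.2 h) (abs_nonneg y),
      mul_nonneg (sub_nonneg.2 h) (sq_nonneg |y|)]

lemma abs_exp_neg_sub_linear_le {w : ℝ} (hw : 0 ≤ w) : |Real.exp (-w) - (1 - w)| ≤ w ^ 2 := by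
  rcases le_total w 1 with h | h
  · have := Real.abs_exp_sub_one_sub_id_le (x := -w) (by rwa [abs_neg, abs_of_nonneg hw])
    rw [show Real.exp (-w) - (1 - w) = Real.exp (-w) - 1 - -w by ring]
    simpa using this
  · have h1 := Real.exp_pos (-w)
    have h2 : Real.exp (-w) ≤ 1 := Real.exp_le_one_iff.2 (by linarith)
    rw [abs_le]
    constructor <;> nlinarith

/-- A law on `ℝ` supported in `[0, 1]` with mean `m` and variance `v`. -/
structure IsUnitLaw (μ : Measure ℝ) (m v : ℝ) : Prop where
  prob : IsProbabilityMeasure μ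
  mem_Icc : ∀ᵐ x ∂μ, x ∈ Set.Icc (0 : ℝ) 1
  mean : ∫ x, x ∂μ = m
  var : ∫ x, (x - m) ^ 2 ∂μ = v

namespace IsUnitLaw

variable {μ : Measure ℝ} {m v : ℝ}

lemma mean_mem (h : IsUnitLaw μ m v) : m ∈ Set.Icc (0 : ℝ) 1 := by
  have := h.prob
  have hi : Integrable (fun x : ℝ => x) μ := by
    refine Integrable.of_bound (by fun_prop) 1 ?_
    filter_upwards [h.mem_Icc] with x hx
    rw [Real.norm_eq_abs, abs_of_nonneg hx.1]; exact hx.2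
  rw [← h.mean]
  constructor
  · exact integral_nonneg_of_ae (by filter_upwards [h.mem_Icc] with x hx using hx.1)
  · have := integral_mono_ae hi (integrable_const (1 : ℝ))
      (by filter_upwards [h.mem_Icc] with x hx using hx.2)
    simpa using this

lemma abs_sub_mean_le (h : IsUnitLaw μ m v) : ∀ᵐ x ∂μ, |x - m| ≤ 1 := by
  filter_upwards [h.mem_Icc] with x hx
  have := h.mean_mem
  rw [abs_le]
  constructor <;> linarith [hx.1, hx.2, this.1, this.2]

lemma var_nonneg (h : IsUnitLaw μ m v) : 0 ≤ v := by
  rw [← h.var]; exact integral_nonneg fun x => sq_nonneg _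

lemma integrable_of_bdd (h : IsUnitLaw μ m v) {E : Type*} [NormedAddCommGroup E]
    {f : ℝ → E} (hf : AEStronglyMeasurable f μ) (C : ℝ)
    (hC : ∀ x, |x - m| ≤ 1 → ‖f x‖ ≤ C) : Integrable f μ := by
  have := h.prob
  refine Integrable.of_bound hf C ?_
  filter_upwards [h.abs_sub_mean_le] with x hx using hC x hx

lemma var_le_one (h : IsUnitLaw μ m v) : v ≤ 1 := by
  have := h.prob
  rw [← h.var]
  have h1 := integral_mono_ae (f := fun x => (x - m) ^ 2) (g := fun _ => (1 : ℝ)) (μ := μ)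
    (h.integrable_of_bdd (by fun_prop) 1 (fun x hx => by
      rw [Real.norm_eq_abs, abs_pow]; exact pow_le_one₀ (abs_nonneg _) hx)) (integrable_const _)
    (by filter_upwards [h.abs_sub_mean_le] with x hx
        rw [← sq_abs]; exact pow_le_one₀ (abs_nonneg _) hx)
  simpa using h1

/-- The characteristic function of the centered law agrees with that of the Gaussian of the same
variance up to third order; for `|t| ≥ 1` the bound is trivial. -/
lemma norm_charFun_sub_gaussian_le (h : IsUnitLaw μ m v) (t : ℝ) :
    ‖∫ x, Complex.exp ((t * (x - m) : ℝ) * Complex.I) ∂μ - (Real.exp (-(v * t ^ 2 / 2)) : ℂ)‖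
      ≤ 6 * |t| ^ 3 := by
  have := h.prob
  have hexp : Integrable (fun x : ℝ => Complex.exp ((t * (x - m) : ℝ) * Complex.I)) μ :=
    h.integrable_of_bdd (by fun_prop) 1
      (fun x _ => (Complex.norm_exp_ofReal_mul_I _).le)
  rcases le_total |t| 1 with ht | ht
  · have hv0 := h.var_nonneg
    have hv1 := h.var_le_one
    have i1 : Integrable (fun x : ℝ => x - m) μ :=
      h.integrable_of_bdd (by fun_prop) 1 fun x hx => hx
    have i2 : Integrable (fun x : ℝ => (x - m) ^ 2) μ :=
      h.integrable_of_bdd (by fun_prop) 1 (fun x hx => by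
        rw [Real.norm_eq_abs, abs_pow]; exact pow_le_one₀ (abs_nonneg _) hx)
    have hx : Integrable (fun x : ℝ => x) μ := 
      (i1.add (integrable_const m)).congr (ae_of_all _ fun x => by simp)
    have j1 : Integrable (fun x : ℝ => ((t * (x - m) : ℝ) : ℂ) * Complex.I) μ :=
      ((i1.const_mul t).ofReal).mul_const _
    have j2 : Integrable (fun x : ℝ => ((t * (x - m) : ℝ) : ℂ) ^ 2 / 2) μ := by
      have := ((i2.const_mul (t ^ 2)).ofReal (𝕜 := ℂ)).div_const 2
      refine this.congr (ae_of_all _ fun x => ?_)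
      simp [mul_pow]
    have j3 : Integrable (fun x : ℝ => 1 + ((t * (x - m) : ℝ) : ℂ) * Complex.I) μ :=
      (integrable_const _).add j1
    have j4 : Integrable (fun x : ℝ => 1 + ((t * (x - m) : ℝ) : ℂ) * Complex.I -
        ((t * (x - m) : ℝ) : ℂ) ^ 2 / 2) μ := j3.sub j2
    have hq : ∫ x, (1 + ((t * (x - m) : ℝ) : ℂ) * Complex.I - ((t * (x - m) : ℝ) : ℂ) ^ 2 / 2) ∂μ
        = ((1 - v * t ^ 2 / 2 : ℝ) : ℂ) := by
      rw [integral_sub j3 j2, integral_add (integrable_const _) j1,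
        integral_mul_const, integral_div]
      have e1 : ∫ x, ((t * (x - m) : ℝ) : ℂ) ∂μ = 0 := by
        rw [integral_complex_ofReal, integral_const_mul, integral_sub hx (integrable_const _),
          h.mean]
        simp
      have e2 : ∫ x, ((t * (x - m) : ℝ) : ℂ) ^ 2 ∂μ = ((v * t ^ 2 : ℝ) : ℂ) := by
        have : ∀ x : ℝ, ((t * (x - m) : ℝ) : ℂ) ^ 2 = ((t ^ 2 * (x - m) ^ 2 : ℝ) : ℂ) := by
          intro x; push_cast; ring
        simp only [this]
        rw [integral_complex_ofReal, integral_const_mul, h.var, mul_comm]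
      rw [e1, e2]; simp
    have hA : ‖∫ x, Complex.exp ((t * (x - m) : ℝ) * Complex.I) ∂μ -
        ((1 - v * t ^ 2 / 2 : ℝ) : ℂ)‖ ≤ 4 * |t| ^ 3 := by
      rw [← hq, ← integral_sub hexp j4]
      refine (norm_integral_le_of_norm_le_const (C := 4 * |t| ^ 3) ?_).trans (by simp)
      filter_upwards [h.abs_sub_mean_le] with x hx
      refine (norm_cexp_sub_quadratic_le _).trans ?_
      rw [abs_mul, mul_pow]
      have : |x - m| ^ 3 ≤ 1 := pow_le_one₀ (abs_nonneg _) hx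
      nlinarith [pow_nonneg (abs_nonneg t) 3]
    have hB : ‖((1 - v * t ^ 2 / 2 : ℝ) : ℂ) - (Real.exp (-(v * t ^ 2 / 2)) : ℂ)‖ ≤
        2 * |t| ^ 3 := by
      rw [← Complex.ofReal_sub, Complex.norm_real, Real.norm_eq_abs, abs_sub_comm]
      refine (abs_exp_neg_sub_linear_le (by positivity)).trans ?_
      have h1 : v * t ^ 2 / 2 ≤ |t| ^ 2 := by
        rw [sq_abs]; nlinarith [sq_nonneg t]
      calc (v * t ^ 2 / 2) ^ 2 ≤ (|t| ^ 2) ^ 2 := by gcongr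
        _ = |t| * |t| ^ 3 := by ring
        _ ≤ 2 * |t| ^ 3 := by nlinarith [pow_nonneg (abs_nonneg t) 3]
    calc _ ≤ _ := norm_sub_le_norm_sub_add_norm_sub _ ((1 - v * t ^ 2 / 2 : ℝ) : ℂ) _
      _ ≤ 6 * |t| ^ 3 := by linarith
  · have h1 : ‖∫ x, Complex.exp ((t * (x - m) : ℝ) * Complex.I) ∂μ‖ ≤ 1 := by
      refine (norm_integral_le_of_norm_le_const (C := 1) ?_).trans (by simp)
      exact ae_of_all _ fun x => (Complex.norm_exp_ofReal_mul_I _).le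
    have h2 : ‖(Real.exp (-(v * t ^ 2 / 2)) : ℂ)‖ ≤ 1 := by
      rw [Complex.norm_real, Real.norm_eq_abs, abs_of_pos (Real.exp_pos _), Real.exp_le_one_iff]
      have := h.var_nonneg
      have : 0 ≤ v * t ^ 2 / 2 := by positivity
      linarith
    refine (norm_sub_le _ _).trans ?_
    have : 1 ≤ |t| ^ 3 := one_le_pow₀ ht
    linarith

end IsUnitLaw

/-- Telescoping bound for products of numbers in the unit disc. -/
lemma norm_prod_sub_prod_le {ι : Type*} (s : Finset ι) (f g : ι → ℂ) (hf : ∀ i ∈ s, ‖f i‖ ≤ 1)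
    (hg : ∀ i ∈ s, ‖g i‖ ≤ 1) :
    ‖∏ i ∈ s, f i - ∏ i ∈ s, g i‖ ≤ ∑ i ∈ s, ‖f i - g i‖ := by
  classical
  induction s using Finset.induction_on with
  | empty => simp
  | insert a s ha ih =>
    rw [Finset.prod_insert ha, Finset.prod_insert ha, Finset.sum_insert ha]
    have ih' := ih (fun i hi => hf i (Finset.mem_insert_of_mem hi))
      (fun i hi => hg i (Finset.mem_insert_of_mem hi))
    have hp : ‖∏ i ∈ s, f i‖ ≤ 1 := by
      rw [norm_prod]
      exact Finset.prod_le_one (fun _ _ => norm_nonneg _)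
        (fun i hi => hf i (Finset.mem_insert_of_mem hi))
    calc ‖f a * ∏ i ∈ s, f i - g a * ∏ i ∈ s, g i‖
        = ‖(f a - g a) * ∏ i ∈ s, f i + g a * (∏ i ∈ s, f i - ∏ i ∈ s, g i)‖ := by ring_nf
      _ ≤ ‖f a - g a‖ * ‖∏ i ∈ s, f i‖ + ‖g a‖ * ‖∏ i ∈ s, f i - ∏ i ∈ s, g i‖ := by
        refine (norm_add_le _ _).trans ?_
        rw [norm_mul, norm_mul]
      _ ≤ ‖f a - g a‖ * 1 + 1 * ∑ i ∈ s, ‖f i - g i‖ := by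
        gcongr
        exact hg a (Finset.mem_insert_self _ _)
      _ = _ := by ring

/-- Quantitative central limit theorem for linear combinations of independent centered
variables, on the level of characteristic functions. -/
lemma IsUnitLaw.norm_charFun_linear_sub_gaussian_le {μ : Measure ℝ} {m v : ℝ}
    (h : IsUnitLaw μ m v) {ι : Type*} [Fintype ι] (u : ι → ℝ) :
    ‖∫ x, Complex.exp ((∑ j, u j * (x j - m) : ℝ) * Complex.I) ∂(Measure.pi fun _ : ι => μ) -
      (Real.exp (-(v * (∑ j, u j ^ 2) / 2)) : ℂ)‖ ≤ ∑ j, 6 * |u j| ^ 3 := by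
  have := h.prob
  have h1 : ∫ x, Complex.exp ((∑ j, u j * (x j - m) : ℝ) * Complex.I) ∂(Measure.pi fun _ : ι => μ)
      = ∏ j, ∫ x, Complex.exp ((u j * (x - m) : ℝ) * Complex.I) ∂μ := by
    rw [← integral_fintype_prod_eq_prod
      (f := fun j (x : ℝ) => Complex.exp ((u j * (x - m) : ℝ) * Complex.I))]
    refine integral_congr_ae (ae_of_all _ fun x => ?_)
    simp only
    rw [← Complex.exp_sum, Complex.ofReal_sum, Finset.sum_mul]
  have h2 : (Real.exp (-(v * (∑ j, u j ^ 2) / 2)) : ℂ) =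
      ∏ j, (Real.exp (-(v * u j ^ 2 / 2)) : ℂ) := by
    rw [← Complex.ofReal_prod, ← Real.exp_sum]
    congr 2
    rw [Finset.mul_sum, Finset.sum_div, Finset.sum_neg_distrib]
  rw [h1, h2]
  refine (norm_prod_sub_prod_le _ _ _ ?_ ?_).trans
    (Finset.sum_le_sum fun j _ => h.norm_charFun_sub_gaussian_le (u j))
  · intro j _
    refine (norm_integral_le_of_norm_le_const (C := 1) ?_).trans (by simp)
    exact ae_of_all _ fun x => (Complex.norm_exp_ofReal_mul_I _).le
  · intro j _
    rw [Complex.norm_real, Real.norm_eq_abs, abs_of_pos (Real.exp_pos _), Real.exp_le_one_iff]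
    have := h.var_nonneg
    have : 0 ≤ v * u j ^ 2 / 2 := by positivity
    linarith

/-! ### Second moments of the empirical characteristic function -/

/-- If `∑ p j ^ 2` vanishes, the real parts of `p j` carry half of the energy in every direction
`τ`. -/
lemma sum_re_conj_mul_sq {ι : Type*} [Fintype ι] (τ : ℂ) (p : ι → ℂ) (hp : ∑ j, p j ^ 2 = 0) :
    ∑ j, ((starRingEnd ℂ τ) * p j).re ^ 2 = ‖τ‖ ^ 2 / 2 * ∑ j, ‖p j‖ ^ 2 := by
  have h : ∀ w : ℂ, w.re ^ 2 = (‖w‖ ^ 2 + (w ^ 2).re) / 2 := by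
    intro w
    rw [← Complex.normSq_eq_norm_sq, Complex.normSq_apply, sq w, Complex.mul_re]; ring
  have h2 : ∑ j, (((starRingEnd ℂ τ) * p j) ^ 2).re = 0 := by
    rw [← Complex.re_sum]
    simp [mul_pow, ← Finset.mul_sum, hp]
  simp_rw [h, ← Finset.sum_div, Finset.sum_add_distrib, h2, norm_mul, mul_pow, ← Finset.mul_sum,
    RCLike.norm_conj]
  ring

section Frequencies
variable {n : ℕ} [NeZero n]

lemma sum_stdAddChar_sq {k : ZMod n} (hk : 2 * k ≠ 0) :
    ∑ j : ZMod n, (ZMod.stdAddChar (j * k) : ℂ) ^ 2 = 0 := by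
  have : ∀ j : ZMod n, (ZMod.stdAddChar (j * k) : ℂ) ^ 2 = ZMod.stdAddChar (j * (2 * k)) := by
    intro j
    rw [sq, ← AddChar.map_add_eq_mul]; congr 1; ring
  simp only [this, sum_stdAddChar_mul, if_neg hk]

lemma sum_stdAddChar_sub_sq {k l : ZMod n} (hk : 2 * k ≠ 0) (hl : 2 * l ≠ 0) (hkl : k + l ≠ 0) :
    ∑ j : ZMod n, ((ZMod.stdAddChar (j * k) : ℂ) - ZMod.stdAddChar (j * l)) ^ 2 = 0 := by
  have : ∀ j : ZMod n, ((ZMod.stdAddChar (j * k) : ℂ) - ZMod.stdAddChar (j * l)) ^ 2 =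
      (ZMod.stdAddChar (j * k) : ℂ) ^ 2 + (ZMod.stdAddChar (j * l) : ℂ) ^ 2 -
        2 * ZMod.stdAddChar (j * (k + l)) := by
    intro j
    rw [mul_add, AddChar.map_add_eq_mul]; ring
  simp only [this, Finset.sum_sub_distrib, Finset.sum_add_distrib, sum_stdAddChar_sq hk,
    sum_stdAddChar_sq hl, ← Finset.mul_sum, sum_stdAddChar_mul, if_neg hkl]
  simp

lemma sum_norm_stdAddChar_sub_sq {k l : ZMod n} (hkl : k ≠ l) :
    ∑ j : ZMod n, ‖(ZMod.stdAddChar (j * k) : ℂ) - ZMod.stdAddChar (j * l)‖ ^ 2 = 2 * n := by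
  have : ∀ j : ZMod n, ((‖(ZMod.stdAddChar (j * k) : ℂ) - ZMod.stdAddChar (j * l)‖ ^ 2 : ℝ) : ℂ) =
      2 - ZMod.stdAddChar (j * (k - l)) - ZMod.stdAddChar (j * (l - k)) := by
    intro j
    rw [← Complex.normSq_eq_norm_sq, ← Complex.mul_conj, map_sub, conj_stdAddChar, conj_stdAddChar,
      sub_mul, mul_sub, mul_sub, ← AddChar.map_add_eq_mul, ← AddChar.map_add_eq_mul,
      ← AddChar.map_add_eq_mul, ← AddChar.map_add_eq_mul, add_neg_cancel, add_neg_cancel,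
      AddChar.map_zero_eq_one, show j * k + -(j * l) = j * (k - l) by ring,
      show j * l + -(j * k) = j * (l - k) by ring]
    ring
  have h2 : ((∑ j : ZMod n, ‖(ZMod.stdAddChar (j * k) : ℂ) - ZMod.stdAddChar (j * l)‖ ^ 2 : ℝ) : ℂ)
      = 2 * n := by
    rw [Complex.ofReal_sum]
    simp only [this, Finset.sum_sub_distrib, sum_stdAddChar_mul, if_neg (sub_ne_zero.2 hkl),
      if_neg (sub_ne_zero.2 hkl.symm)]
    simp [ZMod.card, mul_comm]
  exact_mod_cast h2

/-- The coefficient of the `j`-th entry of the pattern in the linear form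
`⟪τ, z_k⟫`, where `z_k` is the normalized Fourier coefficient at frequency `k`. -/
def freqWeight (τ : ℂ) (k j : ZMod n) : ℝ :=
  ((starRingEnd ℂ τ) * ZMod.stdAddChar (j * k)).re / √n

/-- The Fourier coefficient of the pattern `x` centered at `m`, normalized to order one. -/
def freqCoeff (m : ℝ) (x : ZMod n → ℝ) (k : ZMod n) : ℂ :=
  maskDFT (fun j => x j - m) k / (√n : ℝ)

lemma inner_freqCoeff (τ : ℂ) (m : ℝ) (x : ZMod n → ℝ) (k : ZMod n) :
    inner ℝ τ (freqCoeff m x k) = ∑ j, freqWeight τ k j * (x j - m) := by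
  rw [Complex.inner, mul_comm, freqCoeff, maskDFT, mul_div_assoc', Complex.div_ofReal_re,
    Finset.mul_sum, Complex.re_sum, Finset.sum_div]
  refine Finset.sum_congr rfl fun j _ => ?_
  rw [freqWeight, ← mul_assoc, Complex.re_mul_ofReal]
  ring

lemma sqrt_natCast_pos : 0 < √(n : ℝ) := Real.sqrt_pos.2 (Nat.cast_pos.2 (NeZero.pos n))

lemma abs_freqWeight_le (τ : ℂ) (k j : ZMod n) : |freqWeight τ k j| ≤ ‖τ‖ / √n := by
  rw [freqWeight, abs_div, abs_of_pos (sqrt_natCast_pos (n := n))]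
  gcongr
  refine (Complex.abs_re_le_norm _).trans ?_
  rw [norm_mul, RCLike.norm_conj, norm_stdAddChar, mul_one]

lemma sum_freqWeight_sq (τ : ℂ) {k : ZMod n} (hk : 2 * k ≠ 0) :
    ∑ j, freqWeight τ k j ^ 2 = ‖τ‖ ^ 2 / 2 := by
  have hn : (n : ℝ) ≠ 0 := Nat.cast_ne_zero.2 (NeZero.ne n)
  simp only [freqWeight, div_pow, ← Finset.sum_div, Real.sq_sqrt (Nat.cast_nonneg n),
    sum_re_conj_mul_sq τ _ (sum_stdAddChar_sq hk), norm_stdAddChar]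
  simp [ZMod.card]

lemma sum_freqWeight_sub_sq (τ : ℂ) {k l : ZMod n} (hk : 2 * k ≠ 0) (hl : 2 * l ≠ 0)
    (hkl : k + l ≠ 0) (hne : k ≠ l) :
    ∑ j, (freqWeight τ k j - freqWeight τ l j) ^ 2 = ‖τ‖ ^ 2 := by
  have hn : (n : ℝ) ≠ 0 := Nat.cast_ne_zero.2 (NeZero.ne n)
  simp only [freqWeight, ← sub_div, ← Complex.sub_re, ← mul_sub, div_pow, ← Finset.sum_div,
    Real.sq_sqrt (Nat.cast_nonneg n), sum_re_conj_mul_sq τ _ (sum_stdAddChar_sub_sq hk hl hkl),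
    sum_norm_stdAddChar_sub_sq hne]
  field_simp

/-- The error of the Gaussian approximation for coefficients of order `1 / √n`. The constant `2`
leaves room for the difference of the coefficients at two frequencies. -/
lemma sum_abs_cube_le (τ : ℂ) (u : ZMod n → ℝ) (hu : ∀ j, |u j| ≤ 2 * (‖τ‖ / √n)) :
    ∑ j, 6 * |u j| ^ 3 ≤ 48 * ‖τ‖ ^ 3 / √n := by
  have hs := sqrt_natCast_pos (n := n)
  have h1 : ∀ j, 6 * |u j| ^ 3 ≤ 6 * (2 * (‖τ‖ / √n)) ^ 3 := fun j => by
    have := hu j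
    gcongr
  refine (Finset.sum_le_sum fun j _ => h1 j).trans (le_of_eq ?_)
  rw [Finset.sum_const, Finset.card_univ, ZMod.card, nsmul_eq_mul]
  have : (n : ℝ) = √n ^ 2 := (Real.sq_sqrt (Nat.cast_nonneg n)).symm
  field_simp
  rw [this, Real.sqrt_sq hs.le]
  ring

@[fun_prop]
lemma continuous_freqCoeff (m : ℝ) (k : ZMod n) : Continuous fun x => freqCoeff m x k := by
  unfold freqCoeff maskDFT; fun_prop

lemma norm_ofReal_exp_neg_le_one {w : ℝ} (hw : 0 ≤ w) : ‖(Real.exp (-w) : ℂ)‖ ≤ 1 := by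
  rw [Complex.norm_real, Real.norm_eq_abs, abs_of_pos (Real.exp_pos _), Real.exp_le_one_iff]
  linarith

/-- Asymptotic pairwise independence: for generic pairs of frequencies the
covariance of the deviations of the characters from their Gaussian mean is negligible. -/
lemma IsUnitLaw.norm_integral_cross_le {μ : Measure ℝ} {m v : ℝ} (h : IsUnitLaw μ m v) (τ : ℂ)
    {k l : ZMod n} (hk : 2 * k ≠ 0) (hl : 2 * l ≠ 0) (hkl : k + l ≠ 0) (hne : k ≠ l) :
    ‖∫ x, (Complex.exp ((inner ℝ τ (freqCoeff m x k) : ℝ) * Complex.I) -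
          (Real.exp (-(v * ‖τ‖ ^ 2 / 4)) : ℂ)) *
        (starRingEnd ℂ) (Complex.exp ((inner ℝ τ (freqCoeff m x l) : ℝ) * Complex.I) -
          (Real.exp (-(v * ‖τ‖ ^ 2 / 4)) : ℂ)) ∂(Measure.pi fun _ : ZMod n => μ)‖
      ≤ 3 * (48 * ‖τ‖ ^ 3 / √n) := by
  have := h.prob
  set φ : ℂ := (Real.exp (-(v * ‖τ‖ ^ 2 / 4)) : ℂ) with hφ
  have hv := h.var_nonneg
  have hφ1 : ‖φ‖ ≤ 1 := norm_ofReal_exp_neg_le_one (by positivity)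
  have hb : 0 ≤ ‖τ‖ / √(n : ℝ) := by positivity
  have e1 := (h.norm_charFun_linear_sub_gaussian_le
    (fun j => freqWeight τ k j - freqWeight τ l j)).trans (sum_abs_cube_le τ _ fun j => by
      refine (abs_sub _ _).trans ?_
      linarith [abs_freqWeight_le τ k j, abs_freqWeight_le τ l j])
  have e2 := (h.norm_charFun_linear_sub_gaussian_le
    (fun j => freqWeight τ k j)).trans (sum_abs_cube_le τ _ fun j => by
      linarith [abs_freqWeight_le τ k j, hb])
  have e3 := (h.norm_charFun_linear_sub_gaussian_le
    (fun j => -freqWeight τ l j)).trans (sum_abs_cube_le τ _ fun j => by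
      rw [abs_neg]; linarith [abs_freqWeight_le τ l j, hb])
  rw [sum_freqWeight_sub_sq τ hk hl hkl hne] at e1
  rw [sum_freqWeight_sq τ hk] at e2
  simp only [neg_sq, sum_freqWeight_sq τ hl] at e3
  have hφ2 : φ ^ 2 = (Real.exp (-(v * ‖τ‖ ^ 2 / 2)) : ℂ) := by
    rw [hφ, ← Complex.ofReal_pow, ← Real.exp_nat_mul]; congr 2; push_cast; ring
  have hφ3 : φ = (Real.exp (-(v * (‖τ‖ ^ 2 / 2) / 2)) : ℂ) := by
    rw [hφ]; congr 2; ring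
  rw [← hφ2] at e1
  rw [← hφ3] at e2 e3
  have hint : ∀ u : ZMod n → ℝ, Integrable (fun x : ZMod n → ℝ =>
      Complex.exp ((∑ j, u j * (x j - m) : ℝ) * Complex.I)) (Measure.pi fun _ : ZMod n => μ) := by
    intro u
    exact Integrable.of_bound (Continuous.aestronglyMeasurable (by fun_prop)) 1
      (ae_of_all _ fun x => (Complex.norm_exp_ofReal_mul_I _).le)
  -- the product of the two deviations is a combination of exponentials of linear forms
  have hexp : ∀ x : ZMod n → ℝ, (Complex.exp ((inner ℝ τ (freqCoeff m x k) : ℝ) * Complex.I) - φ) *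
        (starRingEnd ℂ) (Complex.exp ((inner ℝ τ (freqCoeff m x l) : ℝ) * Complex.I) - φ) =
      (Complex.exp ((∑ j, (freqWeight τ k j - freqWeight τ l j) * (x j - m) : ℝ) * Complex.I)
        - φ * Complex.exp ((∑ j, freqWeight τ k j * (x j - m) : ℝ) * Complex.I))
        - φ * Complex.exp ((∑ j, -freqWeight τ l j * (x j - m) : ℝ) * Complex.I) + φ ^ 2 := by
    intro x
    have hφc : (starRingEnd ℂ) φ = φ := Complex.conj_ofReal _
    have c1 : (starRingEnd ℂ) (Complex.exp ((∑ j, freqWeight τ l j * (x j - m) : ℝ) * Complex.I)) =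
        Complex.exp ((∑ j, -freqWeight τ l j * (x j - m) : ℝ) * Complex.I) := by
      rw [← Complex.exp_conj, map_mul, Complex.conj_I, Complex.conj_ofReal]
      simp only [neg_mul, Finset.sum_neg_distrib]
      push_cast; congr 1; ring
    have c2 : Complex.exp ((∑ j, (freqWeight τ k j - freqWeight τ l j) * (x j - m) : ℝ) * Complex.I)
        = Complex.exp ((∑ j, freqWeight τ k j * (x j - m) : ℝ) * Complex.I) *
          Complex.exp ((∑ j, -freqWeight τ l j * (x j - m) : ℝ) * Complex.I) := by
      rw [← Complex.exp_add, ← add_mul, ← Complex.ofReal_add, ← Finset.sum_add_distrib]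
      congr 3
      exact Finset.sum_congr rfl fun j _ => by ring_nf
    rw [inner_freqCoeff, inner_freqCoeff, map_sub, c1, c2, hφc]
    ring
  simp only [hexp]
  have a1 := (hint fun j => freqWeight τ k j - freqWeight τ l j)
  have a2 := (hint fun j => freqWeight τ k j).const_mul φ
  have a3 := (hint fun j => -freqWeight τ l j).const_mul φ
  have a4 := a1.sub a2
  have a5 := a4.sub a3
  simp only [Pi.sub_def] at a4 a5
  rw [integral_add a5 (integrable_const _), integral_sub a4 a3, integral_sub a1 a2,
    integral_const_mul, integral_const_mul, integral_const]
  simp only [probReal_univ, one_smul]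
  set I1 := ∫ x, Complex.exp ((∑ j, (freqWeight τ k j - freqWeight τ l j) * (x j - m) : ℝ) *
    Complex.I) ∂(Measure.pi fun _ : ZMod n => μ)
  set I2 := ∫ x, Complex.exp ((∑ j, freqWeight τ k j * (x j - m) : ℝ) *
    Complex.I) ∂(Measure.pi fun _ : ZMod n => μ)
  set I3 := ∫ x, Complex.exp ((∑ j, -freqWeight τ l j * (x j - m) : ℝ) *
    Complex.I) ∂(Measure.pi fun _ : ZMod n => μ)
  calc ‖I1 - φ * I2 - φ * I3 + φ ^ 2‖
      = ‖(I1 - φ ^ 2) - φ * (I2 - φ) - φ * (I3 - φ)‖ := by congr 1; ring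
    _ ≤ ‖I1 - φ ^ 2‖ + ‖φ‖ * ‖I2 - φ‖ + ‖φ‖ * ‖I3 - φ‖ := by
        rw [← norm_mul, ← norm_mul]
        exact (norm_sub_le _ _).trans (add_le_add_left (norm_sub_le _ _) _)
    _ ≤ ‖I1 - φ ^ 2‖ + 1 * ‖I2 - φ‖ + 1 * ‖I3 - φ‖ := by gcongr
    _ ≤ _ := by linarith

/-- A pair of frequencies is exceptional if `k = ± l`, or if `2 k = 0` or `2 l = 0`; then the
orthogonality relations fail. -/
lemma sum_exceptional_pairs_le : ∑ k : ZMod n, ∑ l : ZMod n,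
    ((if k = l then 1 else 0) + (if k + l = 0 then 1 else 0) + (if 2 * k = 0 then 1 else 0) +
      (if 2 * l = 0 then 1 else 0) : ℝ) ≤ 6 * n := by
  have hc : ∑ k : ZMod n, (if 2 * k = 0 then 1 else 0 : ℝ) ≤ 2 := by
    rw [Finset.sum_boole]; exact_mod_cast card_two_mul_eq_zero_le n
  have hn : (0 : ℝ) ≤ n := Nat.cast_nonneg n
  have h2 : ∀ k l : ZMod n, (k + l = 0) = (l = -k) := fun k l => by
    rw [add_comm, add_eq_zero_iff_eq_neg]
  simp only [Finset.sum_add_distrib, Finset.sum_ite_eq, Finset.mem_univ, if_true, Finset.sum_const,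
    Finset.card_univ, ZMod.card, nsmul_eq_mul, h2, Finset.sum_ite_eq', mul_one, ← Finset.mul_sum]
  nlinarith

/-- The empirical characteristic function of the normalized Fourier coefficients is close in
mean square to that of the complex Gaussian of variance `v`. -/
lemma IsUnitLaw.integral_norm_empiricalCharFun_sub_sq_le {μ : Measure ℝ} {m v : ℝ}
    (h : IsUnitLaw μ m v) (τ : ℂ) :
    ∫ x, ‖(∑ k, Complex.exp ((inner ℝ τ (freqCoeff m x k) : ℝ) * Complex.I)) / n -
        (Real.exp (-(v * ‖τ‖ ^ 2 / 4)) : ℂ)‖ ^ 2 ∂(Measure.pi fun _ : ZMod n => μ)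
      ≤ 144 * ‖τ‖ ^ 3 / √n + 24 / n := by
  have := h.prob
  have hv := h.var_nonneg
  have hn : (0 : ℝ) < n := Nat.cast_pos.2 (NeZero.pos n)
  set φ : ℂ := (Real.exp (-(v * ‖τ‖ ^ 2 / 4)) : ℂ) with hφ
  have hφ1 : ‖φ‖ ≤ 1 := norm_ofReal_exp_neg_le_one (by positivity)
  set T : (ZMod n → ℝ) → ZMod n → ℂ := fun x k =>
    Complex.exp ((inner ℝ τ (freqCoeff m x k) : ℝ) * Complex.I) - φ with hT
  have hTc : ∀ k, Continuous fun x => T x k := by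
    intro k; simp only [hT]; fun_prop
  have hT2 : ∀ x k, ‖T x k‖ ≤ 2 := fun x k => by
    refine (norm_sub_le _ _).trans ?_
    rw [Complex.norm_exp_ofReal_mul_I]; linarith
  have hTT : ∀ k l x, ‖T x k * (starRingEnd ℂ) (T x l)‖ ≤ 4 := fun k l x => by
    rw [norm_mul, RCLike.norm_conj]
    nlinarith [hT2 x k, hT2 x l, norm_nonneg (T x k), norm_nonneg (T x l)]
  have hi : ∀ k l, Integrable (fun x => T x k * (starRingEnd ℂ) (T x l))
      (Measure.pi fun _ : ZMod n => μ) := by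
    intro k l
    refine Integrable.of_bound (Continuous.aestronglyMeasurable ?_) 4 (ae_of_all _ (hTT k l))
    exact (hTc k).mul (Complex.continuous_conj.comp (hTc l))
  have hexp : ∀ x,
      ((‖(∑ k, Complex.exp ((inner ℝ τ (freqCoeff m x k) : ℝ) * Complex.I)) / n - φ‖ ^ 2 : ℝ) : ℂ) =
        (∑ k, ∑ l, T x k * (starRingEnd ℂ) (T x l)) / (n : ℂ) ^ 2 := by
    intro x
    have h1 : (∑ k, Complex.exp ((inner ℝ τ (freqCoeff m x k) : ℝ) * Complex.I)) / n - φ =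
        (∑ k, T x k) / n := by
      have hnc : (n : ℂ) ≠ 0 := Nat.cast_ne_zero.2 (NeZero.ne n)
      simp only [hT, Finset.sum_sub_distrib, Finset.sum_const, Finset.card_univ, ZMod.card,
        nsmul_eq_mul]
      rw [sub_div, mul_div_cancel_left₀ _ hnc]
    rw [h1, ← Complex.normSq_eq_norm_sq, ← Complex.mul_conj, ← Finset.sum_mul_sum, map_div₀,
      map_sum, Complex.conj_natCast]
    ring
  have hbound : ∀ k l, ‖∫ x, T x k * (starRingEnd ℂ) (T x l) ∂(Measure.pi fun _ : ZMod n => μ)‖ ≤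
      3 * (48 * ‖τ‖ ^ 3 / √n) + 4 * ((if k = l then 1 else 0) + (if k + l = 0 then 1 else 0) +
        (if 2 * k = 0 then 1 else 0) + (if 2 * l = 0 then 1 else 0)) := by
    intro k l
    have hpos : 0 ≤ 3 * (48 * ‖τ‖ ^ 3 / √(n : ℝ)) := by positivity
    by_cases hg : 2 * k ≠ 0 ∧ 2 * l ≠ 0 ∧ k + l ≠ 0 ∧ k ≠ l
    · obtain ⟨a, b, c, d⟩ := hg
      rw [if_neg a, if_neg b, if_neg c, if_neg d]
      refine (h.norm_integral_cross_le τ a b c d).trans ?_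
      norm_num
    · have h4 : ‖∫ x, T x k * (starRingEnd ℂ) (T x l) ∂(Measure.pi fun _ : ZMod n => μ)‖ ≤ 4 :=
        (norm_integral_le_of_norm_le_const (ae_of_all _ (hTT k l))).trans (by simp)
      have h5 : (1 : ℝ) ≤ (if k = l then 1 else 0) + (if k + l = 0 then 1 else 0) +
        (if 2 * k = 0 then 1 else 0) + (if 2 * l = 0 then 1 else 0) := by
        split_ifs <;> first | (exfalso; tauto) | norm_num
      linarith
  have hkey : (((∫ x,
      ‖(∑ k, Complex.exp ((inner ℝ τ (freqCoeff m x k) : ℝ) * Complex.I)) / n - φ‖ ^ 2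
        ∂(Measure.pi fun _ : ZMod n => μ)) : ℝ) : ℂ) =
      (∑ k, ∑ l, ∫ x, T x k * (starRingEnd ℂ) (T x l) ∂(Measure.pi fun _ : ZMod n => μ)) /
        (n : ℂ) ^ 2 := by
    rw [← integral_complex_ofReal]
    simp only [hexp]
    rw [integral_div, integral_finsetSum _ fun k _ => integrable_finsetSum _ fun l _ => hi k l]
    simp only [integral_finsetSum _ fun l _ => hi _ l]
  calc _ ≤ ‖(((∫ x, ‖(∑ k, Complex.exp ((inner ℝ τ (freqCoeff m x k) : ℝ) * Complex.I)) / n - φ‖ ^ 2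
      ∂(Measure.pi fun _ : ZMod n => μ)) : ℝ) : ℂ)‖ := by
        rw [Complex.norm_real]; exact le_abs_self _
    _ ≤ (∑ k : ZMod n, ∑ l : ZMod n, (3 * (48 * ‖τ‖ ^ 3 / √n) + 4 * ((if k = l then 1 else 0) +
          (if k + l = 0 then 1 else 0) + (if 2 * k = 0 then 1 else 0) +
          (if 2 * l = 0 then 1 else 0)))) / (n : ℝ) ^ 2 := by
        rw [hkey, norm_div, norm_pow, Complex.norm_natCast]
        gcongr
        exact norm_sum_le_of_le _ fun k _ => norm_sum_le_of_le _ fun l _ => hbound k l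
    _ ≤ (n * (n * (3 * (48 * ‖τ‖ ^ 3 / √n))) + 4 * (6 * n)) / (n : ℝ) ^ 2 := by
        gcongr
        rw [Finset.sum_congr rfl fun k _ => Finset.sum_add_distrib, Finset.sum_add_distrib]
        simp only [Finset.sum_const, Finset.card_univ, ZMod.card, nsmul_eq_mul, ← Finset.mul_sum]
        gcongr
        exact sum_exceptional_pairs_le
    _ = _ := by field_simp; ring

end Frequencies

/-! ### The limiting law and superpositions of `L¹` limits -/

lemma integral_symmRayleigh (f : ℝ → ℝ) :
    ∫ x, f x ∂symmRayleigh = ∫ x, |x| * Real.exp (-x ^ 2) * f x := by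
  rw [symmRayleigh, integral_withDensity_eq_integral_toReal_smul (by fun_prop)
    (ae_of_all _ fun x => ENNReal.ofReal_lt_top)]
  refine integral_congr_ae (ae_of_all _ fun x => ?_)
  simp only [smul_eq_mul]
  rw [ENNReal.toReal_ofReal (by positivity)]

lemma integrable_symmRayleigh_iff {f : ℝ → ℝ} :
    Integrable f symmRayleigh ↔ Integrable fun x => |x| * Real.exp (-x ^ 2) * f x := by
  rw [symmRayleigh, integrable_withDensity_iff_integrable_smul' (by fun_prop)
    (ae_of_all _ fun x => ENNReal.ofReal_lt_top)]
  refine integrable_congr (ae_of_all _ fun x => ?_)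
  simp only [smul_eq_mul]
  rw [ENNReal.toReal_ofReal (by positivity)]

/-- The square of a `symmRayleigh` variable is exponentially distributed. -/
lemma integral_exp_neg_mul_sq_symmRayleigh {s : ℝ} (hs : 0 ≤ s) :
    ∫ x, Real.exp (-(s * x ^ 2)) ∂symmRayleigh = 1 / (1 + s) := by
  have h1 : ∫ x in Set.Ioi (0 : ℝ), x * Real.exp (-(1 + s) * x ^ 2) = (2 * (1 + s))⁻¹ := by
    have := integral_mul_cexp_neg_mul_sq (b := ((1 + s : ℝ) : ℂ))
      (by rw [Complex.ofReal_re]; linarith)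
    have h2 : ∀ r : ℝ, (r : ℂ) * Complex.exp (-((1 + s : ℝ) : ℂ) * (r : ℂ) ^ 2) =
        ((r * Real.exp (-(1 + s) * r ^ 2) : ℝ) : ℂ) := by intro r; push_cast; rfl
    simp only [h2] at this
    rw [integral_complex_ofReal] at this
    exact_mod_cast this
  rw [integral_symmRayleigh]
  have h3 : ∀ x : ℝ, |x| * Real.exp (-x ^ 2) * Real.exp (-(s * x ^ 2)) =
      (fun y => y * Real.exp (-(1 + s) * y ^ 2)) |x| := by
    intro x
    simp only [sq_abs]
    rw [mul_assoc, ← Real.exp_add]; congr 2; ring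
  simp only [h3]
  rw [integral_comp_abs (f := fun y => y * Real.exp (-(1 + s) * y ^ 2)), h1]
  field_simp

lemma integrable_sq_symmRayleigh : Integrable (fun x : ℝ => x ^ 2) symmRayleigh := by
  rw [integrable_symmRayleigh_iff]
  have := (integrable_rpow_mul_exp_neg_mul_sq (b := 1) one_pos (s := 3) (by norm_num)).norm
  refine this.congr (ae_of_all _ fun x => ?_)
  simp only [norm_mul, Real.norm_eq_abs, Real.abs_exp]
  rw [show (3 : ℝ) = (3 : ℕ) by norm_num, Real.rpow_natCast, abs_pow, ← sq_abs x, neg_one_mul]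
  ring

instance : IsProbabilityMeasure symmRayleigh := by
  have hi : Integrable (fun _ : ℝ => (1 : ℝ)) symmRayleigh := by
    rw [integrable_symmRayleigh_iff]
    have := (integrable_mul_exp_neg_mul_sq (b := 1) one_pos).norm
    refine this.congr (ae_of_all _ fun x => ?_)
    simp
  have hfin : IsFiniteMeasure symmRayleigh := by
    simpa [integrable_const_iff] using hi
  have := integral_exp_neg_mul_sq_symmRayleigh le_rfl
  simp at this
  exact ⟨by rwa [measureReal_def, ENNReal.toReal_eq_one_iff] at this⟩

lemma symmRayleigh_singleton_zero : symmRayleigh {0} = 0 :=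
  (withDensity_absolutelyContinuous _ _) (by simp)

lemma integrable_log_symmRayleigh {c : ℝ} (hc : 0 ≤ c) :
    Integrable (fun x : ℝ => Real.log (c * x ^ 2 + 1)) symmRayleigh := by
  refine (integrable_sq_symmRayleigh.const_mul c).mono'
    (Measurable.aestronglyMeasurable (by fun_prop)) (ae_of_all _ fun x => ?_)
  have h : 0 ≤ c * x ^ 2 := by positivity
  rw [Real.norm_eq_abs, abs_of_nonneg (Real.log_nonneg (by linarith))]
  linarith [Real.log_le_sub_one_of_pos (x := c * x ^ 2 + 1) (by linarith)]

lemma limitMI_lt_limitMI {c d : ℝ} (hc : 0 ≤ c) (hcd : c < d) : limitMI c < limitMI d := by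
  rw [← sub_pos, limitMI, limitMI, ← integral_sub (integrable_log_symmRayleigh (hc.trans hcd.le))
    (integrable_log_symmRayleigh hc)]
  have hpos : ∀ x : ℝ, x ≠ 0 → 0 < Real.log (d * x ^ 2 + 1) - Real.log (c * x ^ 2 + 1) := by
    intro x hx
    have hx2 : 0 < x ^ 2 := by positivity
    exact sub_pos.2 (Real.log_lt_log (by positivity) (by nlinarith))
  rw [integral_pos_iff_support_of_nonneg]
  · refine lt_of_lt_of_le ?_ (measure_mono (s := {0}ᶜ) fun x hx => (hpos x hx).ne')
    rw [prob_compl_eq_one_sub (measurableSet_singleton 0), symmRayleigh_singleton_zero]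
    simp
  · intro x
    rcases eq_or_ne x 0 with rfl | hx
    · simp
    · exact (hpos x hx).le
  · exact (integrable_log_symmRayleigh (hc.trans hcd.le)).sub (integrable_log_symmRayleigh hc)

/-- `L¹` convergence to zero is preserved by dominated superpositions. -/
lemma tendsto_integral_abs_integral {X : Type*} [MeasurableSpace X] {κ : Measure X} [SFinite κ]
    {Ω : ℕ → Type*} [∀ n, MeasurableSpace (Ω n)] (P : ∀ n, Measure (Ω n))
    [∀ n, IsProbabilityMeasure (P n)] {H : ∀ n, X → Ω n → ℝ}
    (hm : ∀ n, StronglyMeasurable (Function.uncurry (H n))) {g : X → ℝ} (hg : Integrable g κ)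
    (hb : ∀ n x, ∀ᵐ ω ∂P n, |H n x ω| ≤ g x)
    (hlim : ∀ᵐ x ∂κ, Tendsto (fun n => ∫ ω, |H n x ω| ∂P n) atTop (𝓝 0)) :
    Tendsto (fun n => ∫ ω, |∫ x, H n x ω ∂κ| ∂P n) atTop (𝓝 0) := by
  have hmx : ∀ n, StronglyMeasurable fun x => ∫ ω, |H n x ω| ∂P n := fun n =>
    StronglyMeasurable.integral_prod_right (f := fun x ω => |H n x ω|) (hm n).norm
  have hle : ∀ n x, ‖∫ ω, |H n x ω| ∂P n‖ ≤ g x := by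
    intro n x
    have h1 : ‖∫ ω, |H n x ω| ∂P n‖ ≤ g x * (P n).real Set.univ := by
      refine norm_integral_le_of_norm_le_const ?_
      filter_upwards [hb n x] with ω hω
      rwa [Real.norm_eq_abs, abs_abs]
    simpa using h1
  have hint : ∀ n, Integrable (Function.uncurry (H n)) (κ.prod (P n)) := by
    intro n
    rw [integrable_prod_iff (hm n).aestronglyMeasurable]
    constructor
    · refine ae_of_all _ fun x => Integrable.of_bound
        ((hm n).comp_measurable measurable_prodMk_left).aestronglyMeasurable (g x) (hb n x)
    · exact hg.mono' (hmx n).aestronglyMeasurable (ae_of_all _ (hle n))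
  have hzero : Tendsto (fun n => ∫ x, ∫ ω, |H n x ω| ∂P n ∂κ) atTop (𝓝 0) := by
    have := tendsto_integral_of_dominated_convergence (f := fun _ : X => (0 : ℝ)) g
      (fun n => (hmx n).aestronglyMeasurable) hg (fun n => ae_of_all _ (hle n)) hlim
    simpa using this
  refine squeeze_zero (fun n => integral_nonneg fun ω => abs_nonneg _) (fun n => ?_) hzero
  rw [integral_integral_swap (f := fun x ω => |H n x ω|) (hint n).abs]
  exact integral_mono (hint n).integral_prod_right.abs (hint n).abs.integral_prod_right
    fun ω => abs_integral_le_integral_abs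

/-! ### Laplace transforms of the power spectrum -/

/-- The average of `f (‖z_k‖²)` over all frequencies `k`. -/
def powerMean {n : ℕ} [NeZero n] (m : ℝ) (f : ℝ → ℝ) (x : ZMod n → ℝ) : ℝ :=
  (∑ k, f (‖freqCoeff m x k‖ ^ 2)) / n

/-- The average of `f (‖z_k‖²)` over the frequencies converges in `L¹` to its expectation
`E f (v X²)` for `X` with law `symmRayleigh`, when the entries of the pattern are independent with
law `μ`, centered at `m`. Here `v` is meant to be the variance of `μ`. The patterns have length
`n + 1`, so that `ZMod (n + 1)` is never the infinite ring `ZMod 0`. -/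
def PowerMeanTendsto (μ : Measure ℝ) (m v : ℝ) (f : ℝ → ℝ) : Prop :=
  Tendsto (fun n => ∫ x, |powerMean (n := n + 1) m f x - ∫ y, f (v * y ^ 2) ∂symmRayleigh|
    ∂(Measure.pi fun _ : ZMod (n + 1) => μ)) atTop (𝓝 0)

lemma sum_const_div {n : ℕ} [NeZero n] (c : ℝ) : (∑ _k : ZMod n, c) / n = c := by
  have hn : (n : ℝ) ≠ 0 := Nat.cast_ne_zero.2 (NeZero.ne n)
  rw [Finset.sum_const, Finset.card_univ, ZMod.card, nsmul_eq_mul]; field_simp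

lemma abs_sum_div_le {n : ℕ} [NeZero n] {f : ZMod n → ℝ} {C : ℝ} (h : ∀ k, |f k| ≤ C) :
    |(∑ k, f k) / n| ≤ C := by
  have hn : (0 : ℝ) < n := Nat.cast_pos.2 (NeZero.pos n)
  rw [abs_div, abs_of_pos hn, ← sum_const_div (n := n) C]
  gcongr
  exact (Finset.abs_sum_le_sum_abs _ _).trans (Finset.sum_le_sum fun k _ => h k)

lemma norm_freqCoeff_sq {n : ℕ} [NeZero n] (m : ℝ) (x : ZMod n → ℝ) (k : ZMod n) :
    ‖freqCoeff m x k‖ ^ 2 = ‖maskDFT (fun j => x j - m) k‖ ^ 2 / n := by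
  rw [freqCoeff, norm_div, div_pow, Complex.norm_real, Real.norm_eq_abs, sq_abs,
    Real.sq_sqrt (Nat.cast_nonneg n)]

/-- Parseval's identity bounds the average power spectrum. -/
lemma powerMean_id_le_one {n : ℕ} [NeZero n] {m : ℝ} {x : ZMod n → ℝ} (hx : ∀ j, |x j - m| ≤ 1) :
    powerMean m (fun y => y) x ≤ 1 := by
  have hn : (0 : ℝ) < n := Nat.cast_pos.2 (NeZero.pos n)
  have h1 : ∑ j, (x j - m) ^ 2 ≤ n := by
    calc ∑ j, (x j - m) ^ 2 ≤ ∑ _j : ZMod n, (1 : ℝ) := Finset.sum_le_sum fun j _ => by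
          rw [← sq_abs]; exact pow_le_one₀ (abs_nonneg _) (hx j)
      _ = n := by simp [ZMod.card]
  simp only [powerMean, norm_freqCoeff_sq]
  rw [← Finset.sum_div, sum_norm_maskDFT_sq, mul_div_cancel_left₀ _ hn.ne']
  exact (div_le_one hn).2 h1

lemma IsUnitLaw.ae_pi_abs_sub_mean_le {μ : Measure ℝ} {m v : ℝ} (h : IsUnitLaw μ m v)
    {ι : Type*} [Fintype ι] : ∀ᵐ x ∂(Measure.pi fun _ : ι => μ), ∀ j, |x j - m| ≤ 1 := by
  have := h.prob
  exact ae_all_iff.2 fun j => (Measure.quasiMeasurePreserving_eval (fun _ : ι => μ) j).ae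
    (p := fun y => |y - m| ≤ 1) h.abs_sub_mean_le

lemma IsUnitLaw.ae_pi_mem_Icc {μ : Measure ℝ} {m v : ℝ} (h : IsUnitLaw μ m v)
    {ι : Type*} [Fintype ι] :
    ∀ᵐ x ∂(Measure.pi fun _ : ι => μ), ∀ j, x j ∈ Set.Icc (0 : ℝ) 1 := by
  have := h.prob
  exact ae_all_iff.2 fun j => (Measure.quasiMeasurePreserving_eval (fun _ : ι => μ) j).ae
    (p := fun y => y ∈ Set.Icc (0 : ℝ) 1) h.mem_Icc

/-- `PowerMeanTendsto` is stable under superpositions `∫ g t dκ(t)` whose terms grow at most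
linearly with an integrable constant: the average of a linearly growing function is bounded
uniformly in `n`. -/
lemma IsUnitLaw.powerMeanTendsto_integral {μ : Measure ℝ} {m v : ℝ} (h : IsUnitLaw μ m v)
    {X : Type*} [MeasurableSpace X] {κ : Measure X} [SFinite κ] {g : X → ℝ → ℝ}
    (hg : Measurable (Function.uncurry g)) {b : X → ℝ} (hb : Integrable b κ)
    (hgb : ∀ t, ∀ y, 0 ≤ y → |g t y| ≤ b t * (1 + y))
    (hlim : ∀ᵐ t ∂κ, PowerMeanTendsto μ m v (g t)) :
    PowerMeanTendsto μ m v (fun y => ∫ t, g t y ∂κ) := by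
  have := h.prob
  have hv := h.var_nonneg
  have hb0 : ∀ t, 0 ≤ b t := fun t => by
    simpa using (abs_nonneg _).trans (hgb t 0 le_rfl)
  set M := ∫ y, y ^ 2 ∂symmRayleigh
  have hgr : Measurable fun p : X × ℝ => g p.1 (v * p.2 ^ 2) :=
    hg.comp (measurable_fst.prodMk ((measurable_snd.pow_const 2).const_mul v))
  have hbR : Integrable (fun y : ℝ => 1 + v * y ^ 2) symmRayleigh :=
    (integrable_const _).add (integrable_sq_symmRayleigh.const_mul v)
  have hR : Integrable (fun p : X × ℝ => g p.1 (v * p.2 ^ 2)) (κ.prod symmRayleigh) :=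
    (hb.mul_prod hbR).mono' hgr.aestronglyMeasurable
      (ae_of_all _ fun p => hgb _ _ (by positivity))
  have hRb : ∀ t, |∫ y, g t (v * y ^ 2) ∂symmRayleigh| ≤ b t * (1 + v * M) := by
    intro t
    refine abs_integral_le_integral_abs.trans ?_
    have e : b t * (1 + v * M) = ∫ y, b t * (1 + v * y ^ 2) ∂symmRayleigh := by
      rw [integral_const_mul, integral_add (integrable_const _)
        (integrable_sq_symmRayleigh.const_mul v), integral_const_mul]
      simp [M]
    rw [e]
    exact integral_mono_of_nonneg (ae_of_all _ fun y => abs_nonneg _) (hbR.const_mul _)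
      (ae_of_all _ fun y => hgb _ _ (by positivity))
  have hgi : ∀ y, 0 ≤ y → Integrable (fun t => g t y) κ := fun y hy =>
    (hb.mul_const (1 + y)).mono'
      (hg.comp (measurable_id.prodMk measurable_const)).aestronglyMeasurable
      (ae_of_all _ fun t => hgb t y hy)
  have key := tendsto_integral_abs_integral (κ := κ)
    (fun n => Measure.pi fun _ : ZMod (n + 1) => μ)
    (H := fun n t x => powerMean (n := n + 1) m (g t) x - ∫ y, g t (v * y ^ 2) ∂symmRayleigh)
    (g := fun t => 2 * b t + b t * (1 + v * M)) ?_ ((hb.const_mul 2).add (hb.mul_const _)) ?_ hlim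
  · refine key.congr fun n => integral_congr_ae (ae_of_all _ fun x => ?_)
    have hpm : ∫ t, powerMean (n := n + 1) m (g t) x ∂κ =
        powerMean (n := n + 1) m (fun y => ∫ t, g t y ∂κ) x := by
      simp only [powerMean]
      rw [integral_div, integral_finsetSum _ fun k _ => hgi _ (by positivity)]
    have hpi : Integrable (fun t => powerMean (n := n + 1) m (g t) x) κ :=
      (integrable_finsetSum _ fun k _ => hgi _ (by positivity)).div_const _
    simp only
    rw [integral_sub hpi hR.integral_prod_left, hpm, integral_integral_swap
      (f := fun t y => g t (v * y ^ 2)) hR]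
  · intro n
    refine StronglyMeasurable.sub (Measurable.stronglyMeasurable ?_) ?_
    · simp only [powerMean]
      refine (Finset.measurable_sum _ fun k _ => ?_).div_const _
      refine hg.comp (measurable_fst.prodMk ?_)
      have := (continuous_freqCoeff (n := n + 1) m k).measurable
      fun_prop
    · exact (hgr.stronglyMeasurable.integral_prod_right
        (f := fun t y => g t (v * y ^ 2))).comp_measurable measurable_fst
  · intro n t
    filter_upwards [h.ae_pi_abs_sub_mean_le] with x hx
    refine (abs_sub _ _).trans (add_le_add ?_ (hRb t))
    have hn : (0 : ℝ) < ((n + 1 : ℕ) : ℝ) := Nat.cast_pos.2 (NeZero.pos _)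
    calc |powerMean (n := n + 1) m (g t) x|
        ≤ (∑ k : ZMod (n + 1), b t * (1 + ‖freqCoeff m x k‖ ^ 2)) / ((n + 1 : ℕ) : ℝ) := by
          rw [powerMean, abs_div, abs_of_pos hn]
          gcongr
          exact (Finset.abs_sum_le_sum_abs _ _).trans
            (Finset.sum_le_sum fun k _ => hgb _ _ (by positivity))
      _ = b t * (1 + powerMean (n := n + 1) m (fun y => y) x) := by
          rw [← Finset.mul_sum, Finset.sum_add_distrib, mul_div_assoc, add_div, sum_const_div,
            powerMean]
      _ ≤ b t * (1 + 1) := by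
          gcongr
          · exact hb0 t
          · exact powerMean_id_le_one hx
      _ = 2 * b t := by ring

/-- The cosine of a linear form of the normalized Fourier coefficients averages to its complex
Gaussian expectation. -/
lemma IsUnitLaw.tendsto_cos_mean {μ : Measure ℝ} {m v : ℝ} (h : IsUnitLaw μ m v) (τ : ℂ) :
    Tendsto (fun n : ℕ => ∫ x, |(∑ k : ZMod (n + 1), Real.cos (inner ℝ τ (freqCoeff m x k))) /
        ((n + 1 : ℕ) : ℝ) - Real.exp (-(v * ‖τ‖ ^ 2 / 4))|
      ∂(Measure.pi fun _ : ZMod (n + 1) => μ)) atTop (𝓝 0) := by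
  have := h.prob
  have hv := h.var_nonneg
  have hφ1 : ‖(Real.exp (-(v * ‖τ‖ ^ 2 / 4)) : ℂ)‖ ≤ 1 :=
    norm_ofReal_exp_neg_le_one (by positivity)
  have hrate : Tendsto (fun n : ℕ =>
      √(144 * ‖τ‖ ^ 3 / √((n + 1 : ℕ) : ℝ) + 24 / ((n + 1 : ℕ) : ℝ))) atTop (𝓝 0) := by
    have h1 : Tendsto (fun n : ℕ => ((n + 1 : ℕ) : ℝ)) atTop atTop :=
      tendsto_natCast_atTop_atTop.comp (tendsto_add_atTop_nat 1)
    have h2 := ((Real.tendsto_sqrt_atTop.comp h1).const_div_atTop (144 * ‖τ‖ ^ 3)).add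
      (h1.const_div_atTop 24)
    have h3 := (Real.continuous_sqrt.tendsto _).comp h2
    simpa [Function.comp_def] using h3
  refine squeeze_zero (fun n => integral_nonneg fun x => abs_nonneg _) (fun n => ?_) hrate
  set D : (ZMod (n + 1) → ℝ) → ℂ := fun x =>
    (∑ k, Complex.exp ((inner ℝ τ (freqCoeff m x k) : ℝ) * Complex.I)) / ((n + 1 : ℕ) : ℂ) -
        (Real.exp (-(v * ‖τ‖ ^ 2 / 4)) : ℂ) with hD
  have hDc : Continuous D := by simp only [hD]; fun_prop
  have hDb : ∀ x, ‖D x‖ ≤ 2 := by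
    intro x
    refine (norm_sub_le _ _).trans ?_
    have hn : (0 : ℝ) < ((n + 1 : ℕ) : ℝ) := Nat.cast_pos.2 (NeZero.pos _)
    have : ‖(∑ k : ZMod (n + 1), Complex.exp ((inner ℝ τ (freqCoeff m x k) : ℝ) * Complex.I)) /
        ((n + 1 : ℕ) : ℂ)‖ ≤ 1 := by
      rw [norm_div, Complex.norm_natCast, div_le_one hn]
      refine (norm_sum_le _ _).trans ?_
      simp only [Complex.norm_exp_ofReal_mul_I]
      simp [ZMod.card]
    linarith
  have hi1 : Integrable (fun x => ‖D x‖) (Measure.pi fun _ : ZMod (n + 1) => μ) :=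
    Integrable.of_bound hDc.norm.aestronglyMeasurable 2 (ae_of_all _ fun x => by simpa using hDb x)
  have hi2 : MemLp (fun x => ‖D x‖) 2 (Measure.pi fun _ : ZMod (n + 1) => μ) :=
    MemLp.of_bound hDc.norm.aestronglyMeasurable 2 (ae_of_all _ fun x => by simpa using hDb x)
  have hle : ∀ x, |(∑ k : ZMod (n + 1), Real.cos (inner ℝ τ (freqCoeff m x k))) /
      ((n + 1 : ℕ) : ℝ) - Real.exp (-(v * ‖τ‖ ^ 2 / 4))| ≤ ‖D x‖ := by
    intro x
    have : (D x).re = (∑ k : ZMod (n + 1), Real.cos (inner ℝ τ (freqCoeff m x k))) /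
      ((n + 1 : ℕ) : ℝ) - Real.exp (-(v * ‖τ‖ ^ 2 / 4)) := by
      simp only [hD]
      rw [Complex.sub_re, Complex.ofReal_re, Complex.div_natCast_re, Complex.re_sum]
      simp only [Complex.exp_ofReal_mul_I_re]
    rw [← this]
    exact Complex.abs_re_le_norm _
  calc _ ≤ ∫ x, ‖D x‖ ∂(Measure.pi fun _ : ZMod (n + 1) => μ) :=
        integral_mono_of_nonneg (ae_of_all _ fun x => abs_nonneg _) hi1 (ae_of_all _ hle)
    _ ≤ _ := by
        refine Real.le_sqrt_of_sq_le ?_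
        refine le_trans ?_ (h.integral_norm_empiricalCharFun_sub_sq_le (n := n + 1) τ)
        -- `(E ‖D‖)² ≤ E ‖D‖²`
        have := variance_nonneg (fun x => ‖D x‖) (Measure.pi fun _ : ZMod (n + 1) => μ)
        rw [variance_eq_sub hi2, sub_nonneg] at this
        simpa [hD] using this

/-- Gaussian linearization of `exp (-s‖z‖²)`. -/
lemma integral_gaussian_mul_cos {s : ℝ} (hs : 0 ≤ s) (z : ℂ) :
    ∫ w : ℂ, Real.pi⁻¹ * Real.exp (-‖w‖ ^ 2) * Real.cos (inner ℝ ((2 * √s : ℝ) • w) z) =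
      Real.exp (-(s * ‖z‖ ^ 2)) := by
  have h := GaussianFourier.integral_cexp_neg_mul_sq_norm_add (V := ℂ) (b := 1) (by simp)
    ((2 * √s : ℝ) * Complex.I) z
  have hi := GaussianFourier.integrable_cexp_neg_mul_sq_norm_add (V := ℂ) (b := 1) (by simp)
    ((2 * √s : ℝ) * Complex.I) z
  have hre : ∀ w : ℂ, Real.pi⁻¹ * Real.exp (-‖w‖ ^ 2) * Real.cos (inner ℝ ((2 * √s : ℝ) • w) z) =
      Real.pi⁻¹ * RCLike.re (Complex.exp (-1 * (‖w‖ : ℂ) ^ 2 +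
        ((2 * √s : ℝ) * Complex.I) * (inner ℝ z w : ℝ))) := by
    intro w
    rw [real_inner_smul_left, real_inner_comm]
    have : -1 * (‖w‖ : ℂ) ^ 2 + ((2 * √s : ℝ) * Complex.I) * (inner ℝ z w : ℝ) =
        ((-‖w‖ ^ 2 : ℝ) : ℂ) + ((2 * √s * inner ℝ z w : ℝ) : ℂ) * Complex.I := by
      push_cast; ring
    rw [this, Complex.exp_add, ← Complex.ofReal_exp, RCLike.re_eq_complex_re, Complex.re_ofReal_mul,
      Complex.exp_ofReal_mul_I_re, mul_assoc]
  simp only [hre]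
  rw [integral_const_mul, integral_re hi, h]
  have e : (Real.pi / 1 : ℂ) ^ ((Module.finrank ℝ ℂ : ℂ) / 2) *
      Complex.exp (((2 * √s : ℝ) * Complex.I) ^ 2 * (‖z‖ : ℂ) ^ 2 / (4 * 1)) =
      ((Real.pi * Real.exp (-(s * ‖z‖ ^ 2)) : ℝ) : ℂ) := by
    rw [Complex.finrank_real_complex]
    have hss : ((√s : ℝ) : ℂ) ^ 2 = s := by rw [← Complex.ofReal_pow, Real.sq_sqrt hs]
    push_cast
    rw [mul_pow, mul_pow, Complex.I_sq, hss]
    norm_num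
    ring_nf
  rw [e, RCLike.re_eq_complex_re, Complex.ofReal_re, inv_mul_cancel_left₀ Real.pi_ne_zero]

lemma integral_gaussian_mul_gaussian {a : ℝ} (ha : 0 ≤ a) :
    ∫ w : ℂ, Real.pi⁻¹ * Real.exp (-‖w‖ ^ 2) * Real.exp (-(a * ‖w‖ ^ 2)) = 1 / (1 + a) := by
  have h := GaussianFourier.integral_rexp_neg_mul_sq_norm (V := ℂ) (b := 1 + a) (by linarith)
  have hre : ∀ w : ℂ, Real.pi⁻¹ * Real.exp (-‖w‖ ^ 2) * Real.exp (-(a * ‖w‖ ^ 2)) =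
      Real.pi⁻¹ * Real.exp (-(1 + a) * ‖w‖ ^ 2) := by
    intro w; rw [mul_assoc, ← Real.exp_add]; congr 2; ring
  simp only [hre]
  rw [integral_const_mul, h, Complex.finrank_real_complex]
  norm_num
  field_simp

/-- The Laplace transform of the empirical law of the power spectrum converges to that of the
exponential law of mean `v`. -/
lemma IsUnitLaw.powerMeanTendsto_exp {μ : Measure ℝ} {m v : ℝ} (h : IsUnitLaw μ m v) {s : ℝ}
    (hs : 0 ≤ s) : PowerMeanTendsto μ m v (fun y => Real.exp (-(s * y))) := by
  have := h.prob
  have hv := h.var_nonneg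
  have hgi : Integrable (fun w : ℂ => Real.pi⁻¹ * Real.exp (-‖w‖ ^ 2)) := by
    have := (GaussianFourier.integrable_cexp_neg_mul_sq_norm_add (V := ℂ) (b := 1) (by simp)
      0 0).re
    refine (this.const_mul Real.pi⁻¹).congr (ae_of_all _ fun w => ?_)
    simp only [zero_mul, add_zero, neg_mul, one_mul, RCLike.re_eq_complex_re]
    rw [← Complex.ofReal_pow, ← Complex.ofReal_neg, Complex.exp_ofReal_re]
  have key := tendsto_integral_abs_integral (κ := (volume : Measure ℂ))
    (fun n => Measure.pi fun _ : ZMod (n + 1) => μ)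
    (H := fun n w x => Real.pi⁻¹ * Real.exp (-‖w‖ ^ 2) *
      ((∑ k : ZMod (n + 1), Real.cos (inner ℝ ((2 * √s : ℝ) • w) (freqCoeff m x k))) /
        ((n + 1 : ℕ) : ℝ) - Real.exp (-(v * s * ‖w‖ ^ 2))))
    (g := fun w => Real.pi⁻¹ * Real.exp (-‖w‖ ^ 2) * 2) ?_ (hgi.mul_const 2) ?_ ?_
  · refine key.congr fun n => integral_congr_ae (ae_of_all _ fun x => ?_)
    have hci : ∀ k : ZMod (n + 1), Integrable (fun w : ℂ => Real.pi⁻¹ * Real.exp (-‖w‖ ^ 2) *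
        Real.cos (inner ℝ ((2 * √s : ℝ) • w) (freqCoeff m x k))) := fun k =>
      hgi.mul_bdd (c := 1) (Continuous.aestronglyMeasurable (by fun_prop))
        (ae_of_all _ fun w => Real.abs_cos_le_one _)
    have hei : Integrable (fun w : ℂ => Real.pi⁻¹ * Real.exp (-‖w‖ ^ 2) *
        Real.exp (-(v * s * ‖w‖ ^ 2))) :=
      hgi.mul_bdd (c := 1) (Continuous.aestronglyMeasurable (by fun_prop))
        (ae_of_all _ fun w => by
          rw [Real.norm_eq_abs, Real.abs_exp, Real.exp_le_one_iff]
          have : 0 ≤ v * s * ‖w‖ ^ 2 := by positivity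
          linarith)
    have hlimit : ∫ y, Real.exp (-(s * (v * y ^ 2))) ∂symmRayleigh = 1 / (1 + v * s) := by
      rw [← integral_exp_neg_mul_sq_symmRayleigh (by positivity)]
      refine integral_congr_ae (ae_of_all _ fun y => ?_)
      simp only
      congr 1; ring
    simp only [mul_sub, mul_div_assoc', Finset.mul_sum]
    rw [integral_sub ((integrable_finsetSum _ fun k _ => hci k).div_const _) hei, integral_div,
      integral_finsetSum _ fun k _ => hci k, integral_gaussian_mul_gaussian (by positivity), hlimit,
      powerMean]
    simp only [integral_gaussian_mul_cos hs]
  · intro n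
    refine Continuous.stronglyMeasurable ?_
    have : ∀ k : ZMod (n + 1), Continuous fun x => freqCoeff m x k := fun k => by fun_prop
    simp only [Function.uncurry_def]
    fun_prop
  · intro n w
    refine ae_of_all _ fun x => ?_
    have hp : 0 ≤ Real.pi⁻¹ * Real.exp (-‖w‖ ^ 2) := by positivity
    rw [abs_mul, abs_of_nonneg hp]
    refine mul_le_mul_of_nonneg_left ((abs_sub _ _).trans ?_) hp
    have h1 := abs_sum_div_le (n := n + 1)
      (f := fun k => Real.cos (inner ℝ ((2 * √s : ℝ) • w) (freqCoeff m x k))) (C := 1)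
      fun k => Real.abs_cos_le_one _
    have h2 : |Real.exp (-(v * s * ‖w‖ ^ 2))| ≤ 1 := by
      rw [Real.abs_exp, Real.exp_le_one_iff]
      have : 0 ≤ v * s * ‖w‖ ^ 2 := by positivity
      linarith
    linarith
  · refine ae_of_all _ fun w => ?_
    have h1 := (h.tendsto_cos_mean ((2 * √s : ℝ) • w)).const_mul (Real.pi⁻¹ * Real.exp (-‖w‖ ^ 2))
    rw [mul_zero] at h1
    refine h1.congr fun n => ?_
    have hp : 0 ≤ Real.pi⁻¹ * Real.exp (-‖w‖ ^ 2) := by positivity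
    rw [← integral_const_mul]
    refine integral_congr_ae (ae_of_all _ fun x => ?_)
    have e : v * ‖(2 * √s : ℝ) • w‖ ^ 2 / 4 = v * s * ‖w‖ ^ 2 := by
      rw [norm_smul, mul_pow, Real.norm_eq_abs, sq_abs, mul_pow, Real.sq_sqrt hs]; ring
    simp only [abs_mul _ (_ - _), abs_of_nonneg hp, e]

/-! ### The logarithm of the power spectrum and the mutual information -/

/-- Only the values of `f` on `[0, ∞)` matter. -/
lemma PowerMeanTendsto.congr {μ : Measure ℝ} {m v : ℝ} (hv : 0 ≤ v) {f g : ℝ → ℝ}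
    (hf : PowerMeanTendsto μ m v f) (hfg : ∀ y, 0 ≤ y → f y = g y) : PowerMeanTendsto μ m v g := by
  refine Tendsto.congr (fun n => integral_congr_ae (ae_of_all _ fun x => ?_)) hf
  have h1 : ∀ y : ℝ, f (v * y ^ 2) = g (v * y ^ 2) := fun y => hfg _ (by positivity)
  have h2 : ∀ k : ZMod (n + 1), f (‖freqCoeff m x k‖ ^ 2) = g (‖freqCoeff m x k‖ ^ 2) :=
    fun k => hfg _ (by positivity)
  simp only [powerMean, h1, h2]

lemma PowerMeanTendsto.one_sub_div {μ : Measure ℝ} {m v : ℝ} {f : ℝ → ℝ}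
    (hf : PowerMeanTendsto μ m v f) (hi : Integrable (fun y => f (v * y ^ 2)) symmRayleigh)
    (c : ℝ) : PowerMeanTendsto μ m v (fun y => (1 - f y) / c) := by
  have h1 := Tendsto.const_mul |c⁻¹| hf
  rw [mul_zero] at h1
  refine h1.congr fun n => ?_
  rw [← integral_const_mul]
  refine integral_congr_ae (ae_of_all _ fun x => ?_)
  simp only [powerMean]
  rw [integral_div, integral_sub (integrable_const _) hi, ← Finset.sum_div, Finset.sum_sub_distrib,
    div_right_comm, sub_div, sum_const_div, ← abs_mul, ← abs_neg]
  simp only [integral_const, probReal_univ, one_smul]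
  congr 1; ring

lemma integral_exp_neg_mul_exp_neg {w : ℝ} (hw : 0 ≤ w) :
    ∫ s in Set.Ioi (0 : ℝ), Real.exp (-s) * Real.exp (-(|s| * w)) = 1 / (1 + w) := by
  have h := integral_exp_mul_Ioi (a := -(1 + w)) (by linarith) 0
  rw [mul_zero, Real.exp_zero, neg_div_neg_eq] at h
  rw [← h]
  refine setIntegral_congr_fun measurableSet_Ioi fun s hs => ?_
  rw [abs_of_pos hs, ← Real.exp_add]; congr 1; ring

/-- Convergence of the Stieltjes transform, as a mixture of Laplace transforms. -/
lemma IsUnitLaw.powerMeanTendsto_resolvent {μ : Measure ℝ} {m v : ℝ} (h : IsUnitLaw μ m v) {θ : ℝ}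
    (hθ : 0 ≤ θ) : PowerMeanTendsto μ m v (fun y => 1 / (1 + θ * y)) := by
  have hv := h.var_nonneg
  have hb : Integrable (fun s => Real.exp (-s)) (volume.restrict (Set.Ioi (0 : ℝ))) :=
    integrableOn_exp_neg_Ioi 0
  have key := h.powerMeanTendsto_integral (κ := volume.restrict (Set.Ioi (0 : ℝ)))
    -- `|s|` agrees with `s` on the domain of integration and keeps the integrand bounded elsewhere
    (g := fun s y => Real.exp (-s) * Real.exp (-(|s| * (θ * y)))) (b := fun s => Real.exp (-s))
    (by simp only [Function.uncurry_def]; fun_prop) hb ?_ ?_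
  · exact key.congr hv fun y hy => integral_exp_neg_mul_exp_neg (by positivity)
  · intro s y hy
    rw [abs_mul, Real.abs_exp, Real.abs_exp]
    have h0 : 0 ≤ |s| * (θ * y) := by positivity
    gcongr
    linarith [Real.exp_le_one_iff.2 (neg_nonpos.2 h0)]
  · refine ae_of_all _ fun s => ?_
    have h1 := Tendsto.const_mul (Real.exp (-s))
      (h.powerMeanTendsto_exp (s := |s| * θ) (by positivity))
    rw [mul_zero] at h1
    refine h1.congr fun n => ?_
    rw [← integral_const_mul]
    refine integral_congr_ae (ae_of_all _ fun x => ?_)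
    simp only [powerMean, ← mul_assoc]
    rw [integral_const_mul, ← Finset.mul_sum, mul_div_assoc, ← mul_sub, abs_mul, Real.abs_exp]

lemma integral_div_one_add_mul {c y : ℝ} (hc : 0 ≤ c) (hy : 0 ≤ y) :
    ∫ θ in Set.Ioc 0 c, y / (1 + |θ| * y) = Real.log (c * y + 1) := by
  have hpos : ∀ θ ∈ Set.uIcc 0 c, 0 < θ * y + 1 := by
    intro θ hθ
    rw [Set.uIcc_of_le hc] at hθ
    have := mul_nonneg hθ.1 hy
    linarith
  have h := intervalIntegral.integral_eq_sub_of_hasDerivAt (a := 0) (b := c)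
    (f := fun θ => Real.log (θ * y + 1)) (f' := fun θ => y / (θ * y + 1))
    (fun θ hθ => by
      have := (((hasDerivAt_id θ).mul_const y).add_const 1).log (hpos θ hθ).ne'
      simpa using this)
    (ContinuousOn.intervalIntegrable (ContinuousOn.div (by fun_prop) (by fun_prop)
      fun θ hθ => (hpos θ hθ).ne'))
  rw [intervalIntegral.integral_of_le hc] at h
  simp only [zero_mul, zero_add, Real.log_one, sub_zero] at h
  rw [← h]
  refine setIntegral_congr_fun measurableSet_Ioc fun θ hθ => ?_
  rw [abs_of_pos hθ.1, add_comm]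

/-- Law of large numbers for the logarithm of the power spectrum: the logarithm is a mixture of
resolvents. -/
lemma IsUnitLaw.powerMeanTendsto_log {μ : Measure ℝ} {m v : ℝ} (h : IsUnitLaw μ m v) {c : ℝ}
    (hc : 0 ≤ c) : PowerMeanTendsto μ m v (fun y => Real.log (c * y + 1)) := by
  have hv := h.var_nonneg
  have key := h.powerMeanTendsto_integral (κ := volume.restrict (Set.Ioc 0 c))
    (g := fun θ y => y / (1 + |θ| * y)) (b := fun _ => 1)
    (by simp only [Function.uncurry_def]; fun_prop) (integrable_const _) ?_ ?_
  · exact key.congr hv fun y hy => integral_div_one_add_mul hc hy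
  · intro θ y hy
    have h0 : 0 ≤ |θ| * y := by positivity
    rw [abs_of_nonneg (by positivity), one_mul]
    exact (div_le_self hy (by linarith)).trans (by linarith)
  · -- `y / (1 + θ y) = (1 - 1 / (1 + θ y)) / θ` for `θ > 0`
    filter_upwards [ae_restrict_mem measurableSet_Ioc] with θ hθ
    refine ((h.powerMeanTendsto_resolvent hθ.1.le).one_sub_div ?_ θ).congr hv fun y hy => ?_
    · refine Integrable.of_bound (Measurable.aestronglyMeasurable (by fun_prop)) 1
        (ae_of_all _ fun y => ?_)
      have h0 : 0 ≤ θ * (v * y ^ 2) := mul_nonneg hθ.1.le (by positivity)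
      rw [Real.norm_eq_abs, abs_of_nonneg (by positivity)]
      exact div_le_self zero_le_one (by linarith)
    · have hθ0 := hθ.1
      rw [abs_of_pos hθ0]
      have : 1 + θ * y ≠ 0 := by positivity
      field_simp
      ring

lemma norm_maskDFT_sq_le {n : ℕ} [NeZero n] {a : ZMod n → ℝ} (ha : ∀ j, |a j| ≤ 1) (k : ZMod n) :
    ‖maskDFT a k‖ ^ 2 ≤ (n : ℝ) * n := by
  have h1 : ‖maskDFT a k‖ ≤ n := by
    refine (norm_sum_le _ _).trans ?_
    calc ∑ j : ZMod n, ‖(ZMod.stdAddChar (j * k) : ℂ) * (a j : ℂ)‖ ≤ ∑ _j : ZMod n, (1 : ℝ) := by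
          refine Finset.sum_le_sum fun j _ => ?_
          rw [norm_mul, norm_stdAddChar, one_mul, Complex.norm_real]; exact ha j
      _ = n := by simp [ZMod.card]
  rw [← sq]
  gcongr

lemma abs_log_term_sub_le {c y z B : ℝ} (hc : 0 ≤ c) (hy : 0 ≤ y) (hz : 0 ≤ z) (hyB : y ≤ B)
    (hzB : z ≤ B) :
    |Real.log (c * y + 1) - Real.log (c * z + 1)| ≤ Real.log (c * B + 1) := by
  have h1 : ∀ w, 0 ≤ w → w ≤ B → 0 ≤ Real.log (c * w + 1) ∧
      Real.log (c * w + 1) ≤ Real.log (c * B + 1) := by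
    intro w hw hwB
    have : 0 ≤ c * w := mul_nonneg hc hw
    exact ⟨Real.log_nonneg (by linarith), Real.log_le_log (by linarith) (by gcongr)⟩
  have a := h1 y hy hyB
  have b := h1 z hz hzB
  rw [abs_le]
  constructor <;> linarith [a.1, a.2, b.1, b.2]

section MutualInformation
variable {W J ρ : ℝ}

/-- The mean of the entries affects only the zero frequency, hence the mutual information only by
`O(log n / n)`. -/
lemma abs_normalizedMI_sub_powerMean_le (hρ : 0 < W + ρ * J) {n : ℕ} {m : ℝ}
    {x : ZMod (n + 1) → ℝ} (hx : ∀ j, |x j| ≤ 1) (hxm : ∀ j, |x j - m| ≤ 1) :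
    |normalizedMI (n := n + 1) W J ρ x -
      powerMean m (fun y => Real.log (1 / (W + ρ * J) * y + 1)) x| ≤
      Real.log (1 / (W + ρ * J) * ((n + 1 : ℕ) : ℝ) + 1) / ((n + 1 : ℕ) : ℝ) := by
  have hn : (0 : ℝ) < ((n + 1 : ℕ) : ℝ) := Nat.cast_pos.2 (NeZero.pos _)
  have hc : 0 ≤ 1 / (W + ρ * J) := by positivity
  rw [normalizedMI_eq_sum W J ρ hρ n x]
  simp only [powerMean]
  rw [← sub_div, abs_div, abs_of_pos hn,
    ← Finset.sum_sub_distrib, Finset.sum_eq_single (0 : ZMod (n + 1))]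
  · gcongr
    rw [norm_freqCoeff_sq]
    refine abs_log_term_sub_le hc (by positivity) (by positivity) ?_ ?_
    · rw [div_le_iff₀ hn]; exact norm_maskDFT_sq_le hx 0
    · rw [div_le_iff₀ hn]; exact norm_maskDFT_sq_le (a := fun j => x j - m) hxm 0
  · intro k _ hk
    rw [norm_freqCoeff_sq, maskDFT_sub_const x m hk, sub_self]
  · simp

lemma measurable_normalizedMI (hρ : 0 < W + ρ * J) (n : ℕ) :
    Measurable fun x : Fin (n + 1) → ℝ => normalizedMI W J ρ x := by
  have : ∀ k : ZMod (n + 1), Measurable fun x : ZMod (n + 1) → ℝ => maskDFT x k := fun k =>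
    Continuous.measurable (by unfold maskDFT; fun_prop)
  have h2 : Measurable fun x : ZMod (n + 1) → ℝ => (∑ k : ZMod (n + 1),
      Real.log (1 / (W + ρ * J) * (‖maskDFT (n := n + 1) x k‖ ^ 2 / ((n + 1 : ℕ) : ℝ)) + 1)) /
        ((n + 1 : ℕ) : ℝ) := by
    fun_prop
  rw [← funext (normalizedMI_eq_sum W J ρ hρ n)] at h2
  exact h2

lemma measurable_powerMean {n : ℕ} [NeZero n] (m : ℝ) {f : ℝ → ℝ} (hf : Measurable f) :
    Measurable fun x : ZMod n → ℝ => powerMean m f x := by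
  have : ∀ k : ZMod n, Measurable fun x : ZMod n → ℝ => freqCoeff m x k := fun k =>
    (continuous_freqCoeff m k).measurable
  simp only [powerMean]
  fun_prop

lemma IsUnitLaw.integrable_powerMean_log {μ : Measure ℝ} {m v : ℝ} (h : IsUnitLaw μ m v) {c : ℝ}
    (hc : 0 ≤ c) (n : ℕ) [NeZero n] :
    Integrable (fun x => powerMean m (fun y => Real.log (c * y + 1)) x)
      (Measure.pi fun _ : ZMod n => μ) := by
  have := h.prob
  have hn : (0 : ℝ) < n := Nat.cast_pos.2 (NeZero.pos n)
  refine Integrable.of_bound (measurable_powerMean m (by fun_prop)).aestronglyMeasurable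
    (Real.log (c * n + 1)) ?_
  filter_upwards [h.ae_pi_abs_sub_mean_le] with x hx
  refine abs_sum_div_le fun k => ?_
  rw [norm_freqCoeff_sq]
  simpa using abs_log_term_sub_le (z := 0) (B := n) hc (by positivity) le_rfl
    (by rw [div_le_iff₀ hn]; exact norm_maskDFT_sq_le hx k) hn.le

lemma IsUnitLaw.ae_abs_normalizedMI_sub_powerMean_le {μ : Measure ℝ} {m v : ℝ}
    (h : IsUnitLaw μ m v) (hρ : 0 < W + ρ * J) (n : ℕ) :
    ∀ᵐ x ∂(Measure.pi fun _ : Fin (n + 1) => μ), |normalizedMI W J ρ x -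
      powerMean (n := n + 1) m (fun y => Real.log (1 / (W + ρ * J) * y + 1)) x| ≤
      Real.log (1 / (W + ρ * J) * ((n + 1 : ℕ) : ℝ) + 1) / ((n + 1 : ℕ) : ℝ) := by
  filter_upwards [h.ae_pi_abs_sub_mean_le, h.ae_pi_mem_Icc] with x h1 h2
  exact abs_normalizedMI_sub_powerMean_le hρ
    (fun j => by rw [abs_of_nonneg (h2 j).1]; exact (h2 j).2) h1

lemma IsUnitLaw.integrable_normalizedMI {μ : Measure ℝ} {m v : ℝ}
    (h : IsUnitLaw μ m v) (hρ : 0 < W + ρ * J) (n : ℕ) :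
    Integrable (fun x => normalizedMI W J ρ x) (Measure.pi fun _ : Fin (n + 1) => μ) := by
  have := h.prob
  have hp : Integrable (fun x : Fin (n + 1) → ℝ =>
      powerMean (n := n + 1) m (fun y => Real.log (1 / (W + ρ * J) * y + 1)) x)
      (Measure.pi fun _ : Fin (n + 1) => μ) :=
    h.integrable_powerMean_log (c := 1 / (W + ρ * J)) (by positivity) (n + 1)
  have hd : Integrable (fun x : Fin (n + 1) → ℝ => normalizedMI W J ρ x -
      powerMean (n := n + 1) m (fun y => Real.log (1 / (W + ρ * J) * y + 1)) x)
      (Measure.pi fun _ : Fin (n + 1) => μ) :=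
    Integrable.of_bound ((measurable_normalizedMI hρ n).aestronglyMeasurable.sub
      hp.aestronglyMeasurable) _ (h.ae_abs_normalizedMI_sub_powerMean_le hρ n)
  exact (hd.add hp).congr (ae_of_all _ fun x => sub_add_cancel _ _)

lemma tendsto_log_div_natCast {c : ℝ} (hc : 0 < c) :
    Tendsto (fun n : ℕ => Real.log (c * ((n + 1 : ℕ) : ℝ) + 1) / ((n + 1 : ℕ) : ℝ)) atTop
      (𝓝 0) := by
  have h1 : Tendsto (fun n : ℕ => ((n + 1 : ℕ) : ℝ)) atTop atTop :=
    tendsto_natCast_atTop_atTop.comp (tendsto_add_atTop_nat 1)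
  have h2 : Tendsto (fun n : ℕ => c * ((n + 1 : ℕ) : ℝ) + 1) atTop atTop :=
    tendsto_atTop_add_const_right _ _ (h1.const_mul_atTop hc)
  have h3 := (Real.isLittleO_log_id_atTop.tendsto_div_nhds_zero.comp h2).mul
    ((tendsto_inv_atTop_zero.comp h1).const_add c)
  rw [zero_mul] at h3
  refine h3.congr fun n => ?_
  have hn : (0 : ℝ) < ((n + 1 : ℕ) : ℝ) := Nat.cast_pos.2 (NeZero.pos _)
  simp only [Function.comp_apply, id_eq]
  field_simp

/-- For masks with independent entries, the normalized mutual information converges in mean. -/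
lemma IsUnitLaw.tendsto_integral_normalizedMI {μ : Measure ℝ} {m v : ℝ}
    (h : IsUnitLaw μ m v) (hρ : 0 < W + ρ * J) :
    Tendsto (fun n : ℕ => ∫ x, |normalizedMI W J ρ x - limitMI (v / (W + ρ * J))|
      ∂(Measure.pi fun _ : Fin (n + 1) => μ)) atTop (𝓝 0) := by
  have := h.prob
  have h1 := (tendsto_log_div_natCast (c := 1 / (W + ρ * J)) (by positivity)).add
    (h.powerMeanTendsto_log (c := 1 / (W + ρ * J)) (by positivity))
  rw [add_zero] at h1
  refine squeeze_zero (fun n => integral_nonneg fun x => abs_nonneg _) (fun n => ?_) h1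
  have hlim : ∫ y, Real.log (1 / (W + ρ * J) * (v * y ^ 2) + 1) ∂symmRayleigh =
      limitMI (v / (W + ρ * J)) := by
    rw [limitMI]
    refine integral_congr_ae (ae_of_all _ fun y => ?_)
    simp only
    congr 2; ring
  simp only [hlim]
  set f : (Fin (n + 1) → ℝ) → ℝ := fun x =>
    powerMean (n := n + 1) m (fun y => Real.log (1 / (W + ρ * J) * y + 1)) x
  have hf : Integrable f (Measure.pi fun _ : Fin (n + 1) => μ) :=
    h.integrable_powerMean_log (c := 1 / (W + ρ * J)) (by positivity) (n + 1)
  have hf2 : Integrable (fun x => |f x - limitMI (v / (W + ρ * J))|)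
      (Measure.pi fun _ : Fin (n + 1) => μ) := (hf.sub (integrable_const _)).abs
  have hg : Integrable (fun x => |normalizedMI W J ρ x - limitMI (v / (W + ρ * J))|)
      (Measure.pi fun _ : Fin (n + 1) => μ) :=
    ((h.integrable_normalizedMI hρ n).sub (integrable_const _)).abs
  have hle := integral_mono_ae hg ((integrable_const
    (Real.log (1 / (W + ρ * J) * ((n + 1 : ℕ) : ℝ) + 1) / ((n + 1 : ℕ) : ℝ))).add hf2) (by
    filter_upwards [h.ae_abs_normalizedMI_sub_powerMean_le hρ n] with x hx
    exact (abs_sub_le _ (f x) _).trans (add_le_add_left hx _))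
  refine hle.trans (le_of_eq ?_)
  simp only [Pi.add_apply]
  rw [integral_add (integrable_const _) hf2]
  simp only [integral_const, probReal_univ, one_smul]
  rfl

/-- Convergence in probability for a random mask on an arbitrary probability space. -/
lemma IsUnitLaw.tendstoInMeasure_normalizedMI {μ : Measure ℝ} {m v : ℝ}
    (h : IsUnitLaw μ m v) (hρ : 0 < W + ρ * J) {Ω : Type*} [MeasurableSpace Ω] {P : Measure Ω}
    [IsProbabilityMeasure P] {a : (n : ℕ) → Fin n → Ω → ℝ} (hind : ∀ n, iIndepFun (a n) P)
    (hlaw : ∀ n i, HasLaw (a n i) μ P) :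
    TendstoInMeasure P (fun n ω => normalizedMI W J ρ (fun i => a n i ω)) atTop
      (fun _ => limitMI (v / (W + ρ * J))) := by
  have := h.prob
  rw [tendstoInMeasure_iff_measureReal_dist]
  intro ε hε
  rw [← tendsto_add_atTop_iff_nat 1]
  have h1 := (h.tendsto_integral_normalizedMI hρ).const_mul ε⁻¹
  rw [mul_zero] at h1
  refine squeeze_zero (fun n => measureReal_nonneg) (fun n => ?_) h1
  have hmap : P.map (fun ω i => a (n + 1) i ω) = Measure.pi fun _ : Fin (n + 1) => μ := by
    rw [(iIndepFun_iff_map_fun_eq_pi_map fun i => (hlaw (n + 1) i).aemeasurable).1 (hind (n + 1))]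
    congr 1
    funext i
    exact (hlaw (n + 1) i).map_eq
  have hms : MeasurableSet {x : Fin (n + 1) → ℝ |
      ε ≤ |normalizedMI W J ρ x - limitMI (v / (W + ρ * J))|} :=
    measurableSet_le measurable_const ((measurable_normalizedMI hρ n).sub_const _).abs
  have hset : P.real {ω | ε ≤ dist (normalizedMI W J ρ (fun i => a (n + 1) i ω))
      (limitMI (v / (W + ρ * J)))} = (Measure.pi fun _ : Fin (n + 1) => μ).real
        {x | ε ≤ |normalizedMI W J ρ x - limitMI (v / (W + ρ * J))|} := by
    rw [← hmap, measureReal_def, measureReal_def, Measure.map_apply_of_aemeasurable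
      (aemeasurable_pi_lambda _ fun i => (hlaw (n + 1) i).aemeasurable) hms]
    rfl
  rw [hset, le_inv_mul_iff₀ hε]
  exact mul_meas_ge_le_integral_of_nonneg (ae_of_all _ fun x => abs_nonneg _)
    ((h.integrable_normalizedMI hρ n).sub (integrable_const _)).abs ε

end MutualInformation

lemma isUnitLaw_uniform : IsUnitLaw (volume.restrict (Set.Icc (0 : ℝ) 1)) (1 / 2) (1 / 12) where
  prob := ⟨by simp⟩
  mem_Icc := ae_restrict_mem measurableSet_Icc
  mean := by
    rw [integral_Icc_eq_integral_Ioc, ← intervalIntegral.integral_of_le zero_le_one, integral_id]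
    norm_num
  var := by
    rw [integral_Icc_eq_integral_Ioc, ← intervalIntegral.integral_of_le zero_le_one,
      intervalIntegral.integral_comp_sub_right (fun x => x ^ 2), integral_pow]
    norm_num

lemma isUnitLaw_bernoulli (p : unitInterval) :
    IsUnitLaw (bernoulliMeasure (1 : ℝ) 0 p) p (p * (1 - p)) where
  prob := inferInstance
  mem_Icc := by
    rw [ae_iff, bernoulliMeasure_apply_of_notMem_of_notMem]
    · exact measurableSet_Icc.compl
    · simp
    · simp
  mean := by
    rw [integral_bernoulliMeasure]; simp
  var := by
    rw [integral_bernoulliMeasure]; simp; ring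

theorem proposition3 {Ω : Type*} [MeasurableSpace Ω] (P : Measure Ω) [IsProbabilityMeasure P]
    (W J : ℝ) (hW : 0 ≤ W) (hJ : 0 < J)
    (a : (n : ℕ) → Fin n → Ω → ℝ) (ha : ∀ n, IsRandomUniform P (a n)) :
    -- the limiting expectation exists, and the normalized mutual information tends to it
    (Integrable (fun x : ℝ => Real.log ((1 / 12) / (W + J / 2) * x ^ 2 + 1)) symmRayleigh ∧
      TendstoInMeasure P (fun n ω => normalizedMI W J (1 / 2) (fun i => a n i ω)) atTop
        (fun _ => limitMI ((1 / 12) / (W + J / 2)))) ∧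
    -- random on-off masks with `p` in the given range do better
    (∀ p : unitInterval, (p : ℝ) ∈ Set.Icc (1 / 2 - 1 / √6) (1 / 2) →
      limitMI ((1 / 12) / (W + J / 2)) < limitMI ((p : ℝ) * (1 - p) / (W + p * J)) ∧
      Integrable (fun x : ℝ => Real.log ((p : ℝ) * (1 - p) / (W + p * J) * x ^ 2 + 1))
        symmRayleigh ∧
      ∀ b : (n : ℕ) → Fin n → Ω → ℝ, (∀ n, IsRandomOnOff P p (b n)) →
        TendstoInMeasure P (fun n ω => normalizedMI W J p (fun i => b n i ω)) atTop
          (fun _ => limitMI ((p : ℝ) * (1 - p) / (W + p * J))) ∧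
        Tendsto (fun n => P {ω | normalizedMI W J (1 / 2) (fun i => a n i ω) <
          normalizedMI W J p (fun i => b n i ω)}) atTop (𝓝 1)) := by
  have hU : TendstoInMeasure P (fun n ω => normalizedMI W J (1 / 2) (fun i => a n i ω)) atTop
      (fun _ => limitMI ((1 / 12) / (W + J / 2))) := by
    have := isUnitLaw_uniform.tendstoInMeasure_normalizedMI (W := W) (J := J) (ρ := 1 / 2)
      (by positivity) (fun n => (ha n).1) (fun n => (ha n).2)
    rwa [show 1 / 2 * J = J / 2 by ring] at this
  refine ⟨⟨integrable_log_symmRayleigh (by positivity), hU⟩, fun p hp => ?_⟩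
  obtain ⟨hp1, hp2⟩ := hp
  have hs : (1 / √6) ^ 2 = 1 / 6 := by
    rw [div_pow, Real.sq_sqrt (by norm_num)]; norm_num
  have hs0 : 0 < 1 / √6 := by positivity
  have hp0 : 0 < (p : ℝ) := by
    have : 1 / √6 < 1 / 2 := lt_of_pow_lt_pow_left₀ 2 (by norm_num) (by rw [hs]; norm_num)
    linarith
  -- `p (1 - p) = 1/4 - (1/2 - p)²`, and the range of `p` is where `(1/2 - p)² ≤ 1/6`
  have hvar : 1 / 12 ≤ (p : ℝ) * (1 - p) := by
    have : (1 / 2 - (p : ℝ)) ^ 2 ≤ (1 / √6) ^ 2 := by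
      apply pow_le_pow_left₀ <;> linarith
    rw [hs] at this
    nlinarith
  have hρ : 0 < W + (p : ℝ) * J := by positivity
  have hlt : (1 / 12) / (W + J / 2) < (p : ℝ) * (1 - p) / (W + p * J) := by
    rw [div_lt_div_iff₀ (by positivity) hρ]
    rcases hp2.lt_or_eq with h | h
    · nlinarith [mul_pos hJ (sub_pos.2 h),
        mul_nonneg (sub_nonneg.2 hvar) (by positivity : 0 ≤ W + J / 2)]
    · rw [h]; nlinarith
  have hL := limitMI_lt_limitMI (by positivity) hlt
  refine ⟨hL, integrable_log_symmRayleigh ((by positivity : (0 : ℝ) ≤ _).trans hlt.le),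
    fun b hb => ?_⟩
  have hB := (isUnitLaw_bernoulli p).tendstoInMeasure_normalizedMI (W := W) (J := J) (ρ := p)
    hρ (fun n => (hb n).1) (fun n => (hb n).2)
  refine ⟨hB, ?_⟩
  rw [tendstoInMeasure_iff_dist] at hU hB
  set LU := limitMI ((1 / 12) / (W + J / 2))
  set LB := limitMI ((p : ℝ) * (1 - p) / (W + p * J))
  have hδ : 0 < (LB - LU) / 2 := by linarith
  have hbad := (hU _ hδ).add (hB _ hδ)
  have hlow := ENNReal.Tendsto.sub (tendsto_const_nhds (x := (1 : ENNReal))) hbad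
    (Or.inl ENNReal.one_ne_top)
  rw [add_zero, tsub_zero] at hlow
  refine tendsto_of_tendsto_of_tendsto_of_le_of_le hlow tendsto_const_nhds (fun n => ?_)
    (fun n => prob_le_one)
  -- outside two events of vanishing probability both quantities are on their own side of the
  -- midpoint of the limits
  rw [tsub_le_iff_right, ← measure_univ (μ := P)]
  refine (measure_mono ?_).trans ((measure_union_le _ _).trans
    (add_le_add le_rfl (measure_union_le _ _)))
  intro ω _
  by_cases hω : normalizedMI W J (1 / 2) (fun i => a n i ω) <
      normalizedMI W J p (fun i => b n i ω)
  · exact Or.inl hω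
  · right
    by_contra hc
    simp only [Set.mem_union, Set.mem_ofPred_eq, not_or, not_le, Real.dist_eq, abs_lt] at hc
    exact hω (by linarith [hc.1.2, hc.2.1])

end
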